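/- **Notation.** Let $k\in\mathbb N$ (so $k\ge 1$) and $\varrho\in\mathbb H$, and write $z=x+iy\in\mathbb H$. For $\kappa\in\mathbb Z$ put $$\Delta_{2\kappa}=-y^2\Big(\tfrac{\partial^2}{\partial x^2}+\tfrac{\partial^2}{\partial y^2}\Big)+2i\kappa y\Big(\tfrac{\partial}{\partial x}+i\tfrac{\partial}{\partial y}\Big),\qquad \xi_{2\kappa}=2iy^{2\kappa}\overline{\tfrac{\partial}{\partial\overline z}},$$ and let $X_\varrho(z)=\frac{z-\varrho}{z-\overline\varrho}$, $r_\varrho(z)=|X_\varrho(z)|=\tanh(d(z,\varrho)/2)$, where $d$ is the hyperbolic distance. For $0\le Z<1$, $a\in\mathbb N$, $b\in\mathbb Z$ let $$\beta(Z;a,b)=\int_0^Z t^{a-1}(1-t)^{b-1}\,dt,\qquad \beta_0(Z;a,b)=\beta(Z;a,b)-\sum_{\substack{0\le j\le a-1\\ j\ne -b}}\binom{a-1}{j}\frac{(-1)^j}{j+b}.$$ Let $\omega_\varrho$ be the order of the stabilizer of $\varrho$ in $\mathrm{PSL}_2(\mathbb Z)$. For $n_0\in\mathbb N_0$ let $n_k=\min(2k-2,n_0)$.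 A polar harmonic Maass form of weight $2\kappa$ is a function $F:\mathbb H\to\mathbb C$ that is real analytic outside a discrete (in $\mathbb H$) set of points such that: $F(Mz)=(cz+d)^{2\kappa}F(z)$ for all $M=\begin{pmatrix}a&b\\c&d\end{pmatrix}\in\mathrm{SL}_2(\mathbb Z)$; $\Delta_{2\kappa}F=0$ wherever $F$ is real analytic; for every $\mathfrak z\in\mathbb H$ there is $n\in\mathbb N_0$ such that $(z-\mathfrak z)^nF(z)$ is bounded near $\mathfrak z$; and $F(z)=O(e^{Cy})$ as $y\to\infty$, uniformly in $x$, for some $C>0$. Write $\mathcal H_{2\kappa}$ for the set of these forms, and $\mathcal H_{2\kappa}^{\mathrm{cusp}}$ for the subset of those $F$ for which $\xi_{2\kappa}F$ is (away from the singularities of $F$) a cusp form of weight $2-2\kappa$ for $\mathrm{SL}_2(\mathbb Z)$. For $R>0$ and $c^\pm:\mathbb Z\to\mathbb C$, we say that $(\ast)$ holds on the punctured disc $0<r_\varrho(z)<R$ if for every $z\in\mathbb H$ with $0<r_\varrho(z)<R$ the infinite sums below converge absolutely and $$F(z)=(z-\overline\varrho)^{2k-2}\Bigg(\sum_{n\ge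 -n_0}c^+(n)X_\varrho(z)^n+\sum_{n=0}^{n_k}c^-(n)\,\beta\big(1-r_\varrho(z)^2;2k-1,-n\big)X_\varrho(z)^n+\sum_{\substack{n\le n_0\\ n\notin[0,n_k]}}c^-(n)\,\beta_0\big(1-r_\varrho(z)^2;2k-1,-n\big)X_\varrho(z)^n\Bigg).\tag{$\ast$}$$ **Proposition.** (1) Let $R>0$, $n_0\in\mathbb N_0$, and let $F:\mathbb H\to\mathbb C$ be twice continuously differentiable with $\Delta_{2-2k}F=0$ on the punctured disc $0<r_\varrho(z)<R$, such that $r_\varrho(z)^{n_0}F(z)$ is bounded for $z\neq\varrho$ near $\varrho$. Then there exist coefficients $c^\pm(n)\in\mathbb C$ such that $(\ast)$ holds on $0<r_\varrho(z)<R$. (2) Let $F\in\mathcal H_{2-2k}$, and suppose that $(\ast)$ holds on $0<r_\varrho(z)<R$ for some $R>0$, $n_0\in\mathbb N_0$ and coefficients $c^\pm(n)$. Then only $n\equiv k-1\pmod{\omega_\varrho}$ occur: $c^+(n)=0$ for all $n\ge -n_0$ and $c^-(n)=0$ for all $n\le n_0$ with $n\not\equiv k-1\pmod{\omega_\varrho}$.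 If moreover $F\in\mathcal H^{\mathrm{cusp}}_{2-2k}$, then $c^-(n)=0$ for all $0\le n\le n_0$, i.e. the second sum vanishes and the third sum runs only over $n<0$. -/

import Mathlib

open UpperHalfPlane
open scoped ModularForm MatrixGroups Topology ComplexConjugate

noncomputable section

namespace PolarMaass

/-- The partial derivative `∂/∂x` (with `z = x + iy`) of a function on `ℂ`. -/
def dX (f : ℂ → ℂ) (z : ℂ) : ℂ := fderiv ℝ f z 1

/-- The partial derivative `∂/∂y` (with `z = x + iy`) of a function on `ℂ`. -/
def dY (f : ℂ → ℂ) (z : ℂ) : ℂ := fderiv ℝ f z Complex.I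

/-- The weight `2κ` hyperbolic Laplace operator
`Δ_{2κ} = -y² (∂²/∂x² + ∂²/∂y²) + 2iκy (∂/∂x + i ∂/∂y)`, evaluated at `z ∈ ℍ`.
Derivatives of `F : ℍ → ℂ` are those of `F ∘ ofComplex : ℂ → ℂ`, which agrees with `F` on the open
upper half-plane. -/
def laplace (κ : ℤ) (F : ℍ → ℂ) (z : ℍ) : ℂ :=
  -(z.im : ℂ) ^ 2 * (dX (dX (F ∘ ofComplex)) z + dY (dY (F ∘ ofComplex)) z)
    + 2 * Complex.I * (κ : ℂ) * (z.im : ℂ) *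
      (dX (F ∘ ofComplex) z + Complex.I * dY (F ∘ ofComplex) z)

/-- The operator `ξ_{2κ} F = 2i y^{2κ} \overline{∂F/∂z̄}`, where `∂/∂z̄ = (∂/∂x + i ∂/∂y) / 2`. -/
def xi (κ : ℤ) (F : ℍ → ℂ) (z : ℍ) : ℂ :=
  2 * Complex.I * (z.im : ℂ) ^ (2 * κ) *
    conj ((dX (F ∘ ofComplex) z + Complex.I * dY (F ∘ ofComplex) z) / 2)

/-- `F` is real analytic at (hence near) the point `z ∈ ℍ`. -/
def IsRealAnalyticAt (F : ℍ → ℂ) (z : ℍ) : Prop := AnalyticAt ℝ (F ∘ ofComplex) (z : ℂ)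

/-- Polar harmonic Maass forms of weight `2κ` for `SL₂(ℤ)`. The set of points where `F` is not real
analytic is automatically closed in `ℍ`, so that its discreteness means that it has no accumulation
point in `ℍ`. -/
structure IsPolarHarmonicMaassForm (κ : ℤ) (F : ℍ → ℂ) : Prop where
  discrete : IsDiscrete {z : ℍ | ¬ IsRealAnalyticAt F z}
  slash : ∀ M : SL(2, ℤ), F ∣[2 * κ] M = F
  harmonic : ∀ z : ℍ, IsRealAnalyticAt F z → laplace κ F z = 0
  polar : ∀ w : ℍ, ∃ (n : ℕ) (B : ℝ), ∀ᶠ z : ℍ in 𝓝 w, ‖((z : ℂ) - w) ^ n * F z‖ ≤ B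
  growth : ∃ C : ℝ, 0 < C ∧ F =O[atImInfty] fun z : ℍ => Real.exp (C * z.im)

/-- The polar harmonic Maass forms of weight `2κ` that `ξ_{2κ}` maps to a cusp form
(of weight `2 - 2κ` for `SL₂(ℤ)`). -/
def IsPolarHarmonicMaassFormCusp (κ : ℤ) (F : ℍ → ℂ) : Prop :=
  IsPolarHarmonicMaassForm κ F ∧
    ∃ g : CuspForm 𝒮ℒ (2 - 2 * κ), ∀ z : ℍ, IsRealAnalyticAt F z → xi κ F z = g z

/-- `X_ϱ(z) = (z - ϱ) / (z - ϱ̄)`. -/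
def X (ϱ z : ℍ) : ℂ := ((z : ℂ) - ϱ) / ((z : ℂ) - conj (ϱ : ℂ))

/-- `r_ϱ(z) = |X_ϱ(z)|`. -/
def r (ϱ z : ℍ) : ℝ := ‖X ϱ z‖

/-- `r_ϱ(z) = tanh (d(z, ϱ) / 2)` with `d` the hyperbolic distance. -/
theorem r_eq_tanh (ϱ z : ℍ) : r ϱ z = Real.tanh (dist z ϱ / 2) := by
  rw [UpperHalfPlane.tanh_half_dist, r, X, norm_div, Complex.dist_eq, Complex.dist_eq]

/-- The incomplete beta function `β(Z; a, b) = ∫₀^Z t^{a-1} (1-t)^{b-1} dt`, for `0 ≤ Z < 1`,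
`a ≥ 1` and `b ∈ ℤ`. -/
def incBeta (Z : ℝ) (a : ℕ) (b : ℤ) : ℝ :=
  ∫ t in (0 : ℝ)..Z, t ^ (a - 1) * (1 - t) ^ (b - 1)

/-- The constant `𝓒_{a,b} = ∑_{0 ≤ j ≤ a-1, j ≠ -b} binom(a-1, j) (-1)^j / (j + b)`, for `a ≥ 1`. -/
def betaConst (a : ℕ) (b : ℤ) : ℝ :=
  ∑ j ∈ (Finset.range a).filter (fun j : ℕ => (j : ℤ) ≠ -b),
    ((a - 1).choose j : ℝ) * ((-1) ^ j / ((j : ℝ) + (b : ℝ)))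

/-- `β₀(Z; a, b) = β(Z; a, b) - 𝓒_{a,b}`. -/
def incBeta₀ (Z : ℝ) (a : ℕ) (b : ℤ) : ℝ := incBeta Z a b - betaConst a b

/-- `ω_ϱ`, the size of the stabilizer of `ϱ` in `PSL₂(ℤ)`, that is, of the image in
`PSL₂(ℤ) = SL₂(ℤ) / center` of the stabilizer of `ϱ` in `SL₂(ℤ)`. -/
def omega (ϱ : ℍ) : ℕ :=
  Nat.card ((MulAction.stabilizer SL(2, ℤ) ϱ).map
    (QuotientGroup.mk' (Subgroup.center SL(2, ℤ))))

/-- `n_k = min (2k - 2, n₀)`. -/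
def nK (k n₀ : ℕ) : ℤ := min (2 * (k : ℤ) - 2) (n₀ : ℤ)

/-- The `n`-th term `c⁺(n) X_ϱ(z)^n`. -/
def merTerm (ϱ : ℍ) (cp : ℤ → ℂ) (z : ℍ) (n : ℤ) : ℂ := cp n * X ϱ z ^ n

/-- The `n`-th term `c⁻(n) β(1 - r_ϱ(z)²; 2k-1, -n) X_ϱ(z)^n`. -/
def betaTerm (k : ℕ) (ϱ : ℍ) (cm : ℤ → ℂ) (z : ℍ) (n : ℤ) : ℂ :=
  cm n * (incBeta (1 - r ϱ z ^ 2) (2 * k - 1) (-n) : ℂ) * X ϱ z ^ n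

/-- The `n`-th term `c⁻(n) β₀(1 - r_ϱ(z)²; 2k-1, -n) X_ϱ(z)^n`. -/
def beta₀Term (k : ℕ) (ϱ : ℍ) (cm : ℤ → ℂ) (z : ℍ) (n : ℤ) : ℂ :=
  cm n * (incBeta₀ (1 - r ϱ z ^ 2) (2 * k - 1) (-n) : ℂ) * X ϱ z ^ n

/-- The elliptic expansion of `F` (weight `2 - 2k`, pole order bound `n₀`) around `ϱ`, with
coefficients `c⁺ = cp` and `c⁻ = cm`, holds on the punctured hyperbolic disc `0 < r_ϱ(z) < R`:
both infinite series converge absolutely and `F` is given by the three sums. -/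
def HasEllipticExpansion (k : ℕ) (ϱ : ℍ) (n₀ : ℕ) (R : ℝ) (F : ℍ → ℂ) (cp cm : ℤ → ℂ) : Prop :=
  ∀ z : ℍ, z ≠ ϱ → r ϱ z < R →
    Summable (fun n : {n : ℤ // -(n₀ : ℤ) ≤ n} => merTerm ϱ cp z n) ∧
    Summable (fun n : {n : ℤ // n ≤ (n₀ : ℤ) ∧ n ∉ Set.Icc 0 (nK k n₀)} => beta₀Term k ϱ cm z n) ∧
    F z = ((z : ℂ) - conj (ϱ : ℂ)) ^ (2 * k - 2) *
      ((∑' n : {n : ℤ // -(n₀ : ℤ) ≤ n}, merTerm ϱ cp z n)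
        + (∑ n ∈ Finset.Icc 0 (nK k n₀), betaTerm k ϱ cm z n)
        + ∑' n : {n : ℤ // n ≤ (n₀ : ℤ) ∧ n ∉ Set.Icc 0 (nK k n₀)}, beta₀Term k ϱ cm z n)

end PolarMaass

end

/-!
In the disc coordinate `w = X_ϱ(z)` write `F z = (z - ϱ̄) ^ (2k - 2) * f w` (`discFun`). Since
`Δ_{2κ}` is, up to a power of `y`, `∂/∂z` of `y^{2κ} ∂F/∂z̄`
(`dX_sub_I_dY_zpow_mul_dbar`), harmonicity of `F` says that the conjugate of
`y^{2-2k} ∂F/∂z̄` is holomorphic (`conjXi`).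

No Laurent expansion is used: the argument runs on the Fourier coefficients of `f` on the circles
`|w| = exp s`. With `ζ = log w = s + iθ`, the mean over `θ` of a function that is `2πi`-periodic in
`ζ` has `s`-derivative equal to the mean of its `2 ∂/∂ζ̄` (`hasDerivAt_integral_vertical`).
Applied to `w ^ (-n) * f w` this gives
`d/ds (mean) = (1 - e^{2s}) ^ (2k-2) * e^{-2ns} * conj D`,
where `D` is the mean of `w ^ n` times the function `conjXi` in the coordinate `ζ`
(`hasDerivAt_angularMean`). Where `F` is harmonic, the same lemma shows that `D` is constant
(`conjXiMean_eq`). As `β(1 - e^{2s}; 2k-1, -n)` has the same derivative up to the factor `-2`,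
each mean is a combination `p n + q n * betaFactor` of the two radial solutions
(`exists_angularMean_eq`).

*Existence.* The growth condition at `ϱ` kills `q n` for `n > n₀` and `p n` for `n < -n₀`
(`coeff_minus_eq_zero`, `coeff_plus_eq_zero`); in the remaining ranges only one of the two solutions
is present for `|n|` large, and comparison with a slightly larger circle gives absolute convergence
(`summable_plus`, `summable_minus`). A continuous function with summable Fourier coefficients is the
sum of its Fourier series.

*Symmetry.* An element of the stabilizer of `ϱ` acts on the disc as the rotation by `ε²`, where
`ε = cϱ̄ + d` (`X_smul`), and the weight `2 - 2k` gives `f (ε² w) = ε ^ (2k - 2) * f w`. Hence the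
Fourier coefficient of index `n` vanishes on every circle unless `(ε²) ^ (n - k + 1) = 1` for all
such `ε`. If `n ≠ k - 1`, this makes the values `ε²` a finite cyclic group, whose order `ω_ϱ` then
divides `n - k + 1` (`omega_dvd`). A coefficient `p n + q n * betaFactor` that vanishes on all
circles has `p n = q n = 0`, as `betaFactor` is not constant (`betaFactor_ne`).

*Cusp forms.* If `ξF` is a cusp form it is bounded near `ϱ`, so for `n ≥ 0` the mean `D` tends to
`0` as `s → -∞`; but `D` is a nonzero multiple of the conjugate of `c⁻(n)`
(`coeff_minus_eq_zero_of_cusp`).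
-/

open PolarMaass

/-! ### The incomplete beta function -/

lemma continuousAt_betaIntegrand (a : ℕ) (b : ℤ) {t : ℝ} (ht : t < 1) :
    ContinuousAt (fun t : ℝ => t ^ (a - 1) * (1 - t) ^ (b - 1)) t :=
  (continuousAt_id.pow _).mul
    ((continuousAt_const.sub continuousAt_id).zpow₀ _ (Or.inl (sub_pos.2 ht).ne'))

lemma intervalIntegrable_betaIntegrand (a : ℕ) (b : ℤ) {x y : ℝ} (hx : x < 1) (hy : y < 1) :
    IntervalIntegrable (fun t : ℝ => t ^ (a - 1) * (1 - t) ^ (b - 1)) MeasureTheory.volume x y :=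
  ContinuousOn.intervalIntegrable fun _ ht =>
    (continuousAt_betaIntegrand a b (ht.2.trans_lt (max_lt hx hy))).continuousWithinAt

lemma hasDerivAt_incBeta (a : ℕ) (b : ℤ) {Z : ℝ} (hZ : Z < 1) :
    HasDerivAt (fun Z => incBeta Z a b) (Z ^ (a - 1) * (1 - Z) ^ (b - 1)) Z := by
  refine intervalIntegral.integral_hasDerivAt_right
    (intervalIntegrable_betaIntegrand a b one_pos hZ) ?_ (continuousAt_betaIntegrand a b hZ)
  exact ContinuousOn.stronglyMeasurableAtFilter isOpen_Iio
    (fun t ht => (continuousAt_betaIntegrand a b ht).continuousWithinAt) Z hZ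

lemma strictMonoOn_incBeta (a : ℕ) (b : ℤ) :
    StrictMonoOn (fun Z => incBeta Z a b) (Set.Ico 0 1) := by
  refine strictMonoOn_of_deriv_pos (convex_Ico 0 1)
    (fun Z hZ => (hasDerivAt_incBeta a b hZ.2).continuousAt.continuousWithinAt) fun Z hZ => ?_
  rw [interior_Ico] at hZ
  rw [(hasDerivAt_incBeta a b hZ.2).deriv]
  exact mul_pos (pow_pos hZ.1 _) (zpow_pos (sub_pos.2 hZ.2) _)

/-- The growth of `β(1 - x; a, -n)` as `x → 0`, which is of exact order `x ^ (-n)` for `n > 0`. -/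
lemma le_incBeta_one_sub (a n : ℕ) {x : ℝ} (hx : 0 < x) (hx' : x ≤ 1 / 4) :
    (1 / 2) ^ (a - 1) * (2 ^ (n + 1))⁻¹ * (x ^ n)⁻¹ ≤ incBeta (1 - x) a (-n) := by
  have hsplit : incBeta (1 - x) a (-n) = (∫ t in (0 : ℝ)..(1 - 2 * x),
      t ^ (a - 1) * (1 - t) ^ (-(n : ℤ) - 1)) +
      ∫ t in (1 - 2 * x)..(1 - x), t ^ (a - 1) * (1 - t) ^ (-(n : ℤ) - 1) :=
    (intervalIntegral.integral_add_adjacent_intervals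
      (intervalIntegrable_betaIntegrand a _ one_pos (by linarith))
      (intervalIntegrable_betaIntegrand a _ (by linarith) (by linarith))).symm
  have h1 : 0 ≤ ∫ t in (0 : ℝ)..(1 - 2 * x), t ^ (a - 1) * (1 - t) ^ (-(n : ℤ) - 1) :=
    intervalIntegral.integral_nonneg (by linarith) fun t ht =>
      mul_nonneg (pow_nonneg ht.1 _) (zpow_nonneg (by linarith [ht.2]) _)
  have h2 : ∫ _ in (1 - 2 * x)..(1 - x), ((1 / 2 : ℝ) ^ (a - 1) * ((2 * x) ^ (n + 1))⁻¹) ≤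
      ∫ t in (1 - 2 * x)..(1 - x), t ^ (a - 1) * (1 - t) ^ (-(n : ℤ) - 1) := by
    refine intervalIntegral.integral_mono_on (by linarith) intervalIntegrable_const
      (intervalIntegrable_betaIntegrand a _ (by linarith) (by linarith)) fun t ht => ?_
    have e : (1 - t) ^ (-(n : ℤ) - 1) = ((1 - t) ^ (n + 1))⁻¹ := by
      rw [← zpow_natCast, ← zpow_neg]; congr 1; push_cast; ring
    rw [e]
    have : 0 < 1 - t := by linarith [ht.2]
    refine mul_le_mul (pow_le_pow_left₀ (by norm_num) (by linarith [ht.1]) _) ?_ (by positivity)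
      (pow_nonneg (by linarith [ht.1]) _)
    exact inv_anti₀ (pow_pos this _) (pow_le_pow_left₀ this.le (by linarith [ht.1]) _)
  rw [intervalIntegral.integral_const, smul_eq_mul] at h2
  rw [hsplit]
  refine le_trans (le_of_eq ?_) (h2.trans (le_add_of_nonneg_left h1))
  field_simp
  ring

/-- The constant subtracted in `β₀` is the complete beta integral when `b > 0`. -/
lemma betaConst_eq_integral (a m : ℕ) :
    betaConst (a + 1) ((m : ℤ) + 1) = ∫ t in (0 : ℝ)..1, (1 - t) ^ a * t ^ m := by
  have e : ∀ t : ℝ, (1 - t) ^ a * t ^ m =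
      ∑ j ∈ Finset.range (a + 1), ((a.choose j : ℝ) * (-1) ^ j) * t ^ (j + m) := fun t => by
    rw [sub_eq_neg_add, add_pow, Finset.sum_mul]
    refine Finset.sum_congr rfl fun j _ => ?_
    rw [one_pow, neg_pow]; ring
  simp_rw [e]
  rw [intervalIntegral.integral_finsetSum
    (fun j _ => Continuous.intervalIntegrable (by fun_prop) _ _), betaConst,
    Finset.filter_true_of_mem (fun j _ => by omega)]
  refine Finset.sum_congr rfl fun j _ => ?_
  rw [intervalIntegral.integral_const_mul, integral_pow]
  simp only [Nat.add_sub_cancel]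
  push_cast
  rw [one_pow, zero_pow (by omega)]
  ring

/-- For a positive second parameter, `β₀` is minus the complementary incomplete beta integral. -/
lemma incBeta₀_one_sub (a m : ℕ) (x : ℝ) :
    incBeta₀ (1 - x) (a + 1) ((m : ℤ) + 1) = -∫ t in (0 : ℝ)..x, (1 - t) ^ a * t ^ m := by
  have h : incBeta (1 - x) (a + 1) ((m : ℤ) + 1) = ∫ t in x..1, (1 - t) ^ a * t ^ m := by
    have := intervalIntegral.integral_comp_sub_left (a := x) (b := 1)
      (fun t : ℝ => t ^ a * (1 - t) ^ m) 1
    simp only [sub_self, sub_sub_cancel] at this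
    rw [this, incBeta]
    simp
  rw [incBeta₀, h, betaConst_eq_integral, ← intervalIntegral.integral_add_adjacent_intervals
    (Continuous.intervalIntegrable (by fun_prop) 0 x) (Continuous.intervalIntegrable
      (by fun_prop) x 1)]
  ring

lemma abs_incBeta₀_le (a m : ℕ) {x : ℝ} (hx : 0 ≤ x) (hx' : x ≤ 1) :
    |incBeta₀ (1 - x) (a + 1) ((m : ℤ) + 1)| ≤ x ^ (m + 1) / (m + 1) := by
  have h0 : 0 ≤ ∫ t in (0 : ℝ)..x, (1 - t) ^ a * t ^ m :=
    intervalIntegral.integral_nonneg hx fun t ht =>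
      mul_nonneg (pow_nonneg (by linarith [ht.2]) _) (pow_nonneg ht.1 _)
  rw [incBeta₀_one_sub, abs_neg, abs_of_nonneg h0]
  have : x ^ (m + 1) / (m + 1) = ∫ t in (0 : ℝ)..x, t ^ m := by simp [integral_pow]
  rw [this]
  refine intervalIntegral.integral_mono_on hx (Continuous.intervalIntegrable (by fun_prop) _ _)
    (Continuous.intervalIntegrable (by fun_prop) _ _) fun t ht => ?_
  exact mul_le_of_le_one_left (pow_nonneg ht.1 _)
    (pow_le_one₀ (by linarith [ht.2]) (by linarith [ht.1]))

lemma le_abs_incBeta₀ (a m : ℕ) {x : ℝ} (hx : 0 ≤ x) (hx' : x ≤ 1) :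
    (1 - x) ^ a * (x ^ (m + 1) / (m + 1)) ≤ |incBeta₀ (1 - x) (a + 1) ((m : ℤ) + 1)| := by
  rw [incBeta₀_one_sub, abs_neg]
  refine le_trans ?_ (le_abs_self _)
  have : (1 - x) ^ a * (x ^ (m + 1) / (m + 1)) = ∫ t in (0 : ℝ)..x, (1 - x) ^ a * t ^ m := by
    simp [integral_pow]
  rw [this]
  refine intervalIntegral.integral_mono_on hx (Continuous.intervalIntegrable (by fun_prop) _ _)
    (Continuous.intervalIntegrable (by fun_prop) _ _) fun t ht => ?_
  exact mul_le_mul_of_nonneg_right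
    (pow_le_pow_left₀ (by linarith [ht.2]) (by linarith [ht.2]) _) (pow_nonneg ht.1 _)

/-! ### The Cauchy–Riemann operator and angular means -/

/-- The Cauchy–Riemann operator `2 ∂/∂z̄ = ∂/∂x + i ∂/∂y`. -/
noncomputable def dbar (f : ℂ → ℂ) (z : ℂ) : ℂ := dX f z + Complex.I * dY f z

lemma fderiv_apply_eq_re_im (L : ℂ →L[ℝ] ℂ) (c : ℂ) :
    L c = c.re * L 1 + c.im * L Complex.I := by
  conv_lhs => rw [← Complex.re_add_im c]
  have h1 : (c.re : ℂ) + c.im * Complex.I = c.re • (1 : ℂ) + c.im • Complex.I := by simp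
  rw [h1, map_add, map_smul, map_smul]
  simp

/-- The chain and product rules for `2 ∂/∂z̄` when the outer factor and the inner function are
holomorphic. -/
lemma dbar_mul_comp {A G Φ : ℂ → ℂ} {A' Φ' z : ℂ} (hA : HasDerivAt A A' z)
    (hΦ : HasDerivAt Φ Φ' z) (hG : DifferentiableAt ℝ G (Φ z)) :
    dbar (fun ζ => A ζ * G (Φ ζ)) z = A z * conj Φ' * dbar G (Φ z) := by
  have h1 := hA.hasFDerivAt.restrictScalars ℝ
  have h2 := hΦ.hasFDerivAt.restrictScalars ℝ
  have h3 := h1.mul (hG.hasFDerivAt.comp z h2)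
  have h4 : fderiv ℝ (fun ζ => A ζ * G (Φ ζ)) z = _ := h3.fderiv
  rw [dbar, dX, dY, h4, dbar, dX, dY]
  simp only [Function.comp_apply, _root_.add_apply, _root_.smul_apply,
    ContinuousLinearMap.comp_apply, ContinuousLinearMap.coe_restrictScalars',
    ContinuousLinearMap.toSpanSingleton_apply, smul_eq_mul, one_mul]
  rw [fderiv_apply_eq_re_im _ Φ', fderiv_apply_eq_re_im _ (Complex.I * Φ')]
  have e : conj Φ' = (Φ'.re : ℂ) - Φ'.im * Complex.I := by
    apply Complex.ext <;> simp
  simp only [Complex.mul_re, Complex.mul_im, Complex.I_re, Complex.I_im, zero_mul, one_mul,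
    zero_sub, zero_add, e, Complex.ofReal_neg]
  linear_combination (G (Φ z) * A' + A z * Φ'.im * (fderiv ℝ G (Φ z)) Complex.I) *
    Complex.I_mul_I

lemma dbar_eq_zero_of_hasDerivAt {f : ℂ → ℂ} {f' z : ℂ} (h : HasDerivAt f f' z) :
    dbar f z = 0 := by
  rw [dbar, dX, dY, (h.hasFDerivAt.restrictScalars ℝ).fderiv]
  simp only [ContinuousLinearMap.coe_restrictScalars',
    ContinuousLinearMap.toSpanSingleton_apply, smul_eq_mul]
  linear_combination f' * Complex.I_mul_I

/-- For a `2πi`-periodic function on a left half-plane, `d/ds` of the mean over a vertical period is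
the mean of `2 ∂/∂z̄`, because the mean of `∂/∂y` vanishes. -/
lemma hasDerivAt_integral_vertical {L : ℝ} {v : ℂ → ℂ}
    (hv : ContDiffOn ℝ 1 v {ζ | ζ.re < L})
    (hper : ∀ ζ, v (ζ + 2 * Real.pi * Complex.I) = v ζ) {s : ℝ} (hs : s < L) :
    HasDerivAt (fun s : ℝ => ∫ θ in (0 : ℝ)..2 * Real.pi, v (s + θ * Complex.I))
      (∫ θ in (0 : ℝ)..2 * Real.pi, dbar v (s + θ * Complex.I)) s := by
  have hopen : IsOpen {ζ : ℂ | ζ.re < L} := isOpen_lt Complex.continuous_re continuous_const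
  have hfd : ContinuousOn (fderiv ℝ v) {ζ | ζ.re < L} :=
    hv.continuousOn_fderiv_of_isOpen hopen le_rfl
  have hX : ContinuousOn (dX v) {ζ | ζ.re < L} := hfd.clm_apply continuousOn_const
  have hY : ContinuousOn (dY v) {ζ | ζ.re < L} := hfd.clm_apply continuousOn_const
  have hd : ∀ ζ : ℂ, ζ.re < L → DifferentiableAt ℝ v ζ := fun ζ hζ =>
    (hv.contDiffAt (hopen.mem_nhds hζ)).differentiableAt one_ne_zero
  have line : ∀ (f : ℂ → ℂ), ContinuousOn f {ζ | ζ.re < L} → ∀ s : ℝ, s < L →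
      Continuous fun θ : ℝ => f (s + θ * Complex.I) := fun f hf s hs =>
    hf.comp_continuous (by fun_prop) fun θ => by simpa using hs
  obtain ⟨t, hst, htL⟩ := exists_between hs
  -- the derivative is bounded on the compact rectangle `[s - 1, t] × [0, 2π]`
  obtain ⟨C, hC⟩ := ((isCompact_Icc (a := s - 1) (b := t)).prod
    (isCompact_Icc (a := (0 : ℝ)) (b := 2 * Real.pi))).exists_bound_of_continuousOn
      (f := fun p : ℝ × ℝ => dX v (p.1 + p.2 * Complex.I))
      (hX.comp (by fun_prop) fun p hp => by simpa using hp.1.2.trans_lt htL)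
  have main := (intervalIntegral.hasDerivAt_integral_of_dominated_loc_of_deriv_le
    (μ := MeasureTheory.volume) (a := 0) (b := 2 * Real.pi)
    (F := fun (s : ℝ) (θ : ℝ) => v (s + θ * Complex.I))
    (F' := fun (s : ℝ) (θ : ℝ) => dX v (s + θ * Complex.I)) (x₀ := s) (s := Set.Ioo (s - 1) t)
    (bound := fun _ => C) (Ioo_mem_nhds (by linarith) hst) ?_
    ((line v hv.continuousOn s hs).intervalIntegrable _ _)
    (line _ hX s hs).aestronglyMeasurable ?_ intervalIntegrable_const ?_).2
  · have hYint : ∫ θ in (0 : ℝ)..2 * Real.pi, dY v (s + θ * Complex.I) = 0 := by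
      rw [intervalIntegral.integral_eq_sub_of_hasDerivAt
        (f := fun θ : ℝ => v (s + θ * Complex.I)) ?_ ((line _ hY s hs).intervalIntegrable _ _)]
      · have := hper s
        push_cast
        simp [this]
      · intro θ _
        have h1 : HasDerivAt (fun θ : ℝ => (s : ℂ) + θ * Complex.I) Complex.I θ := by
          simpa using ((Complex.ofRealCLM.hasDerivAt (x := θ)).mul_const Complex.I).const_add (s : ℂ)
        exact (hd _ (by simpa using hs)).hasFDerivAt.comp_hasDerivAt θ h1
    have : ∫ θ in (0 : ℝ)..2 * Real.pi, dbar v (s + θ * Complex.I) =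
        ∫ θ in (0 : ℝ)..2 * Real.pi, dX v (s + θ * Complex.I) := by
      simp only [dbar]
      rw [intervalIntegral.integral_add ((line _ hX s hs).intervalIntegrable _ _)
        (((line _ hY s hs).const_mul _).intervalIntegrable _ _ ),
        intervalIntegral.integral_const_mul, hYint, mul_zero, add_zero]
    rw [this]
    exact main
  · filter_upwards [Iio_mem_nhds hs] with x hx
    exact (line v hv.continuousOn x hx).aestronglyMeasurable
  · refine Filter.Eventually.of_forall fun θ hθ x hx => ?_
    rw [Set.uIoc_of_le (by positivity)] at hθ
    exact hC (x, θ) ⟨⟨hx.1.le, hx.2.le⟩, ⟨hθ.1.le, hθ.2⟩⟩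
  · refine Filter.Eventually.of_forall fun θ _ x hx => ?_
    have h1 : HasDerivAt (fun x : ℝ => (x : ℂ) + θ * Complex.I) 1 x :=
      (Complex.ofRealCLM.hasDerivAt (x := x)).add_const _
    exact (hd _ (by simpa using hx.2.trans htL)).hasFDerivAt.comp_hasDerivAt x h1

/-! ### Fourier series -/

instance : Fact ((0 : ℝ) < 2 * Real.pi) := ⟨Real.two_pi_pos⟩

lemma fourier_two_pi (n : ℤ) (θ : ℝ) :
    fourier n (θ : AddCircle (2 * Real.pi)) = Complex.exp (n * θ * Complex.I) := by
  rw [fourier_coe_apply]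
  congr 1
  have : (Real.pi : ℂ) ≠ 0 := by exact_mod_cast Real.pi_ne_zero
  push_cast
  field_simp

/-- A continuous `2π`-periodic function with summable Fourier coefficients is the sum of its Fourier
series. -/
lemma hasSum_fourier_of_summable {u : ℝ → ℂ} (hu : Continuous u)
    (hper : Function.Periodic u (2 * Real.pi)) {A : ℤ → ℂ} (hA : ∀ n : ℤ,
      ∫ θ in (0 : ℝ)..2 * Real.pi, u θ * Complex.exp (-(n * θ * Complex.I)) = 2 * Real.pi * A n)
    (hs : Summable A) (θ : ℝ) :
    HasSum (fun n : ℤ => A n * Complex.exp (n * θ * Complex.I)) (u θ) := by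
  let f : C(AddCircle (2 * Real.pi), ℂ) := ⟨hper.lift, continuous_coinduced_dom.mpr hu⟩
  have hf : ∀ θ : ℝ, f (θ : AddCircle (2 * Real.pi)) = u θ := fun θ => rfl
  have hc : fourierCoeff f = A := by
    ext n
    rw [fourierCoeff_eq_intervalIntegral _ n 0]
    simp_rw [fourier_two_pi, hf, smul_eq_mul, zero_add]
    have : (Real.pi : ℂ) ≠ 0 := by exact_mod_cast Real.pi_ne_zero
    have h2 := hA n
    rw [show (∫ θ in (0 : ℝ)..2 * Real.pi, Complex.exp (((-n : ℤ) : ℂ) * θ * Complex.I) * u θ) =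
      2 * Real.pi * A n from h2 ▸ intervalIntegral.integral_congr fun θ _ => by
        simp only [Int.cast_neg, neg_mul]; ring]
    rw [Complex.real_smul]
    push_cast
    field_simp
  have := has_pointwise_sum_fourier_series_of_summable (f := f) (by rwa [hc]) θ
  simpa only [hc, fourier_two_pi, hf, smul_eq_mul] using this

lemma integral_exp_int_mul_I (n : ℤ) :
    ∫ θ in (0 : ℝ)..2 * Real.pi, Complex.exp (n * θ * Complex.I) =
      if n = 0 then (2 * Real.pi : ℂ) else 0 := by
  split_ifs with h
  · subst h; simp
  · have hn : (n : ℂ) * Complex.I ≠ 0 := by simp [h]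
    have := integral_exp_mul_complex (a := 0) (b := 2 * Real.pi) hn
    rw [show (∫ θ in (0 : ℝ)..2 * Real.pi, Complex.exp (n * θ * Complex.I)) =
      ∫ θ in (0 : ℝ)..2 * Real.pi, Complex.exp (n * Complex.I * θ) from
        intervalIntegral.integral_congr fun θ _ => by ring_nf, this]
    have e : Complex.exp (n * Complex.I * ((2 * Real.pi : ℝ) : ℂ)) = 1 := by
      rw [Complex.exp_eq_one_iff]
      exact ⟨n, by push_cast; ring⟩
    rw [e]
    simp

/-- Fourier coefficients of an absolutely convergent trigonometric series. -/
lemma integral_mul_exp_of_hasSum {u : ℝ → ℂ} {b : ℤ → ℂ} (hb : Summable b)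
    (h : ∀ θ : ℝ, HasSum (fun n : ℤ => b n * Complex.exp (n * θ * Complex.I)) (u θ)) (n : ℤ) :
    ∫ θ in (0 : ℝ)..2 * Real.pi, u θ * Complex.exp (-(n * θ * Complex.I)) =
      2 * Real.pi * b n := by
  have h1 := intervalIntegral.hasSum_integral_of_dominated_convergence
    (μ := MeasureTheory.volume) (a := 0) (b := 2 * Real.pi)
    (F := fun (j : ℤ) (θ : ℝ) => b j * Complex.exp (((j - n : ℤ) : ℂ) * θ * Complex.I))
    (f := fun θ => u θ * Complex.exp (-(n * θ * Complex.I))) (fun j _ => ‖b j‖)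
    (fun j => Continuous.aestronglyMeasurable (by fun_prop))
    (fun j => Filter.Eventually.of_forall fun θ _ => by
      rw [norm_mul, show (((j - n : ℤ) : ℂ) * θ * Complex.I) = (((j - n : ℤ) * θ : ℝ) : ℂ) *
        Complex.I by push_cast; ring, Complex.norm_exp_ofReal_mul_I, mul_one])
    (Filter.Eventually.of_forall fun θ _ => hb.norm) intervalIntegrable_const
    (Filter.Eventually.of_forall fun θ _ => by
      refine ((h θ).mul_right (Complex.exp (-(n * θ * Complex.I)))).congr_fun ?_
      intro j
      rw [mul_assoc (b j), ← Complex.exp_add]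
      congr 2
      push_cast
      ring)
  have h2 := hasSum_single (f := fun j : ℤ => ∫ θ in (0 : ℝ)..2 * Real.pi,
      b j * Complex.exp (((j - n : ℤ) : ℂ) * θ * Complex.I)) n (fun j hj => by
    rw [intervalIntegral.integral_const_mul, integral_exp_int_mul_I, if_neg (sub_ne_zero.2 hj),
      mul_zero])
  rw [h1.unique h2, intervalIntegral.integral_const_mul, integral_exp_int_mul_I, sub_self,
    if_pos rfl]
  ring

/-! ### The disc coordinate -/

/-- The inverse `w ↦ (ϱ - ϱ̄ w) / (1 - w)` of the coordinate `X_ϱ`, mapping the unit disc onto the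
upper half-plane. -/
noncomputable def discPoint (ϱ : ℍ) (w : ℂ) : ℂ := (ϱ - conj (ϱ : ℂ) * w) / (1 - w)

lemma coe_sub_conj (ϱ : ℍ) : (ϱ : ℂ) - conj (ϱ : ℂ) = 2 * Complex.I * ϱ.im := by
  rw [Complex.sub_conj]; push_cast; simp; ring

lemma coe_sub_conj_ne_zero (ϱ : ℍ) : (ϱ : ℂ) - conj (ϱ : ℂ) ≠ 0 := by
  rw [coe_sub_conj]
  have : (ϱ.im : ℂ) ≠ 0 := by exact_mod_cast ϱ.im_pos.ne'
  simp [this]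

lemma coe_sub_conj_coe_ne_zero (ϱ z : ℍ) : (z : ℂ) - conj (ϱ : ℂ) ≠ 0 := by
  intro h
  have := congrArg Complex.im h
  simp only [Complex.sub_im, Complex.conj_im, coe_im, Complex.zero_im] at this
  linarith [z.im_pos, ϱ.im_pos]

lemma one_sub_ne_zero_of_norm_lt {w : ℂ} (hw : ‖w‖ < 1) : 1 - w ≠ 0 := by
  rw [sub_ne_zero]; rintro rfl; simp at hw

lemma discPoint_sub_conj (ϱ : ℍ) {w : ℂ} (hw : ‖w‖ < 1) :
    discPoint ϱ w - conj (ϱ : ℂ) = 2 * Complex.I * ϱ.im / (1 - w) := by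
  have := one_sub_ne_zero_of_norm_lt hw
  rw [discPoint, ← coe_sub_conj]
  field_simp
  ring

lemma discPoint_sub (ϱ : ℍ) {w : ℂ} (hw : ‖w‖ < 1) :
    discPoint ϱ w - ϱ = 2 * Complex.I * ϱ.im * w / (1 - w) := by
  have := one_sub_ne_zero_of_norm_lt hw
  rw [discPoint, ← coe_sub_conj]
  field_simp
  ring

lemma discPoint_im (ϱ : ℍ) (w : ℂ) :
    (discPoint ϱ w).im = ϱ.im * (1 - ‖w‖ ^ 2) / ‖1 - w‖ ^ 2 := by
  rw [discPoint, Complex.div_im, ← Complex.normSq_eq_norm_sq, ← Complex.normSq_eq_norm_sq]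
  simp [Complex.normSq_apply]
  ring

lemma discPoint_im_pos (ϱ : ℍ) {w : ℂ} (hw : ‖w‖ < 1) : 0 < (discPoint ϱ w).im := by
  rw [discPoint_im]
  have h1 : 0 < ‖1 - w‖ := norm_pos_iff.2 (one_sub_ne_zero_of_norm_lt hw)
  have h2 : 0 < 1 - ‖w‖ ^ 2 := by nlinarith [norm_nonneg w]
  have := ϱ.im_pos
  positivity

lemma hasDerivAt_discPoint (ϱ : ℍ) {w : ℂ} (hw : ‖w‖ < 1) :
    HasDerivAt (discPoint ϱ) (2 * Complex.I * ϱ.im / (1 - w) ^ 2) w := by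
  have h := one_sub_ne_zero_of_norm_lt hw
  have h1 : HasDerivAt (fun w : ℂ => (ϱ : ℂ) - conj (ϱ : ℂ) * w) (-conj (ϱ : ℂ)) w := by
    simpa using ((hasDerivAt_id w).const_mul (conj (ϱ : ℂ))).const_sub (ϱ : ℂ)
  have h2 : HasDerivAt (fun w : ℂ => 1 - w) (-1) w := by
    simpa using (hasDerivAt_id w).const_sub (1 : ℂ)
  convert! h1.div h2 h using 1
  rw [← coe_sub_conj]
  congr 1
  ring

lemma X_ofComplex_discPoint (ϱ : ℍ) {w : ℂ} (hw : ‖w‖ < 1) :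
    X ϱ (ofComplex (discPoint ϱ w)) = w := by
  have h := one_sub_ne_zero_of_norm_lt hw
  have h2 : (ϱ.im : ℂ) ≠ 0 := by exact_mod_cast ϱ.im_pos.ne'
  rw [X, ofComplex_apply_of_im_pos (discPoint_im_pos ϱ hw), coe_mk,
    discPoint_sub ϱ hw, discPoint_sub_conj ϱ hw]
  field_simp

lemma discPoint_X (ϱ z : ℍ) : discPoint ϱ (X ϱ z) = z := by
  have h := coe_sub_conj_coe_ne_zero ϱ z
  have h1 : 1 - X ϱ z = ((ϱ : ℂ) - conj (ϱ : ℂ)) / (z - conj (ϱ : ℂ)) := by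
    rw [X]; field_simp; ring
  have h2 := coe_sub_conj_ne_zero ϱ
  rw [discPoint, h1, X, div_eq_iff (div_ne_zero h2 h)]
  field_simp
  ring

lemma r_lt_one (ϱ z : ℍ) : r ϱ z < 1 := by
  rw [r_eq_tanh]; exact Real.tanh_lt_one _

lemma X_eq_zero_iff {ϱ z : ℍ} : X ϱ z = 0 ↔ z = ϱ := by
  rw [X, div_eq_zero_iff, or_iff_left (coe_sub_conj_coe_ne_zero ϱ z), sub_eq_zero,
    UpperHalfPlane.coe_inj]

/-! ### Harmonicity as antiholomorphy of `y^{2κ} ∂F/∂z̄` -/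

/-- A real differentiable function with `∂g/∂z = 0` has a complex differentiable conjugate. -/
lemma differentiableAt_conj_of_dX_eq {g : ℂ → ℂ} {z : ℂ} (hg : DifferentiableAt ℝ g z)
    (h : dX g z - Complex.I * dY g z = 0) : DifferentiableAt ℂ (fun z => conj (g z)) z := by
  rw [differentiableAt_complex_iff_differentiableAt_real]
  have h1 : HasFDerivAt (fun z => conj (g z))
      ((Complex.conjCLE : ℂ →L[ℝ] ℂ).comp (fderiv ℝ g z)) z :=
    (Complex.conjCLE : ℂ →L[ℝ] ℂ).hasFDerivAt.comp z hg.hasFDerivAt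
  refine ⟨h1.differentiableAt, ?_⟩
  rw [h1.fderiv]
  have h2 : fderiv ℝ g z 1 = Complex.I * fderiv ℝ g z Complex.I := sub_eq_zero.1 h
  simp [h2, ← mul_assoc]

lemma hasFDerivAt_fderiv_apply {G : ℂ → ℂ} {z : ℂ} (hG : ContDiffAt ℝ 2 G z) (c : ℂ) :
    HasFDerivAt (fun z => fderiv ℝ G z c) ((fderiv ℝ (fderiv ℝ G) z).flip c) z := by
  have h1 : DifferentiableAt ℝ (fderiv ℝ G) z :=
    (hG.fderiv_right (m := 1) (by norm_num)).differentiableAt one_ne_zero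
  simpa using h1.hasFDerivAt.clm_apply (hasFDerivAt_const c z)

/-- Up to a factor, `∂/∂z` of `y^{2κ} ∂F/∂z̄` is `Δ_{2κ} F`. -/
lemma dX_sub_I_dY_zpow_mul_dbar {G : ℂ → ℂ} {z : ℂ} (hG : ContDiffAt ℝ 2 G z) (hz : 0 < z.im)
    (κ : ℤ) :
    DifferentiableAt ℝ (fun z => (z.im : ℂ) ^ (2 * κ) * dbar G z) z ∧
    dX (fun z => (z.im : ℂ) ^ (2 * κ) * dbar G z) z -
      Complex.I * dY (fun z => (z.im : ℂ) ^ (2 * κ) * dbar G z) z =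
    -(z.im : ℂ) ^ (2 * κ - 2) * (-(z.im : ℂ) ^ 2 * (dX (dX G) z + dY (dY G) z) +
      2 * Complex.I * κ * z.im * (dX G z + Complex.I * dY G z)) := by
  have hy : (z.im : ℂ) ≠ 0 := by exact_mod_cast hz.ne'
  have h1 := hasFDerivAt_fderiv_apply hG 1
  have hI := hasFDerivAt_fderiv_apply hG Complex.I
  have hd : HasFDerivAt (dbar G) _ z := h1.add (hI.const_mul Complex.I)
  have hp : HasFDerivAt (fun z : ℂ => (z.im : ℂ) ^ (2 * κ)) _ z :=
    ((hasDerivAt_zpow (2 * κ) (z.im : ℂ) (Or.inl hy)).hasFDerivAt.restrictScalars ℝ).comp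
      (f := fun z : ℂ => (z.im : ℂ)) z (Complex.ofRealCLM.comp Complex.imCLM).hasFDerivAt
  have hm := hp.mul hd
  have hsymm : (fderiv ℝ (fderiv ℝ G) z) 1 Complex.I = (fderiv ℝ (fderiv ℝ G) z) Complex.I 1 :=
    hG.isSymmSndFDerivAt (by simp) 1 Complex.I
  refine ⟨hm.differentiableAt, ?_⟩
  have e1 : fderiv ℝ (fun z => (z.im : ℂ) ^ (2 * κ) * dbar G z) z = _ := hm.fderiv
  have eX : dX (dX G) z = fderiv ℝ (fderiv ℝ G) z 1 1 := by
    rw [dX, show fderiv ℝ (dX G) z = _ from h1.fderiv]; rfl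
  have eY : dY (dY G) z = fderiv ℝ (fderiv ℝ G) z Complex.I Complex.I := by
    rw [dY, show fderiv ℝ (dY G) z = _ from hI.fderiv]; rfl
  have hz1 : (z.im : ℂ) ^ (2 * κ - 2) = (z.im : ℂ) ^ (2 * κ - 1) / z.im := by
    rw [show 2 * κ - 2 = 2 * κ - 1 - 1 by ring, zpow_sub_one₀ hy, div_eq_mul_inv]
  have hz2 : (z.im : ℂ) ^ (2 * κ) = (z.im : ℂ) ^ (2 * κ - 1) * z.im := by
    rw [← zpow_add_one₀ hy]; congr 1; ring
  rw [eX, eY, dX, dY, e1, hz1]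
  simp only [_root_.add_apply, _root_.smul_apply, ContinuousLinearMap.comp_apply,
    ContinuousLinearMap.flip_apply, ContinuousLinearMap.coe_restrictScalars',
    ContinuousLinearMap.toSpanSingleton_apply, smul_eq_mul, hsymm,
    Complex.imCLM_apply, Complex.ofRealCLM_apply, Complex.one_im, Complex.I_im, hz2, dbar, dX, dY]
  push_cast
  field_simp
  linear_combination (-(z.im : ℂ) * (fderiv ℝ (fderiv ℝ G) z) Complex.I Complex.I) *
    Complex.I_mul_I

lemma differentiableAt_conj_zpow_mul_dbar {κ : ℤ} {F : ℍ → ℂ} {z : ℍ}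
    (hF : ContDiffAt ℝ 2 (F ∘ ofComplex) (z : ℂ)) (h : laplace κ F z = 0) :
    DifferentiableAt ℂ (fun z : ℂ => conj ((z.im : ℂ) ^ (2 * κ) * dbar (F ∘ ofComplex) z)) z := by
  have h1 := dX_sub_I_dY_zpow_mul_dbar hF z.im_pos κ
  refine differentiableAt_conj_of_dX_eq h1.1 (h1.2.trans ?_)
  exact mul_eq_zero_of_right _ h

/-! ### The radial factors of the non-meromorphic part -/

/-- The radial factor of `c⁻(n) X_ϱ(z)^n` in the elliptic expansion, as a function of `ρ = r_ϱ(z)`: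
it is `β(1 - ρ²; 2k-1, -n)` for `0 ≤ n ≤ n_k` and `β₀(1 - ρ²; 2k-1, -n)` otherwise. -/
noncomputable def betaFactor (k n₀ : ℕ) (n : ℤ) (ρ : ℝ) : ℝ :=
  incBeta (1 - ρ ^ 2) (2 * k - 1) (-n) -
    (Set.Icc 0 (nK k n₀))ᶜ.indicator (fun n => betaConst (2 * k - 1) (-n)) n

lemma hasDerivAt_betaFactor_exp {k : ℕ} (n₀ : ℕ) (n : ℤ) {s : ℝ} :
    HasDerivAt (fun s => betaFactor k n₀ n (Real.exp s))
      (-2 * (1 - Real.exp s ^ 2) ^ (2 * k - 2) * Real.exp (-2 * n * s)) s := by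
  have h1 : HasDerivAt (fun s => 1 - Real.exp s ^ 2) (-(2 * Real.exp s ^ 2)) s := by
    convert! ((Real.hasDerivAt_exp s).pow 2).const_sub 1 using 1
    ring
  have hlt : 1 - Real.exp s ^ 2 < 1 := by have := Real.exp_pos s; nlinarith
  have h2 := ((hasDerivAt_incBeta (2 * k - 1) (-n) hlt).comp s h1).sub_const
    ((Set.Icc 0 (nK k n₀))ᶜ.indicator (fun n => betaConst (2 * k - 1) (-n)) n)
  convert! h2 using 1
  have e : (1 - (1 - Real.exp s ^ 2)) ^ (-n - 1) * Real.exp s ^ 2 = Real.exp (-2 * n * s) := by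
    rw [sub_sub_cancel, ← zpow_natCast, ← zpow_mul, ← zpow_add₀ (Real.exp_pos s).ne',
      ← Real.rpow_intCast, ← Real.exp_mul]
    congr 1
    push_cast
    ring
  rw [← e, show 2 * k - 1 - 1 = 2 * k - 2 by omega]
  ring

lemma betaFactor_ne {k : ℕ} (n₀ : ℕ) (n : ℤ) {ρ σ : ℝ} (h0 : 0 < ρ) (h1 : ρ < σ) (h2 : σ < 1) :
    betaFactor k n₀ n ρ ≠ betaFactor k n₀ n σ := by
  intro h
  have h3 : 1 - σ ^ 2 ∈ Set.Ico (0 : ℝ) 1 := ⟨by nlinarith, by nlinarith⟩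
  have h4 : 1 - ρ ^ 2 ∈ Set.Ico (0 : ℝ) 1 := ⟨by nlinarith, by nlinarith⟩
  have := strictMonoOn_incBeta (2 * k - 1) (-n) h3 h4 (by nlinarith)
  simp only [betaFactor, sub_left_inj] at h
  exact this.ne h.symm

lemma betaFactor_of_neg {k : ℕ} (hk : 1 ≤ k) (n₀ m : ℕ) (ρ : ℝ) :
    betaFactor k n₀ (-((m : ℤ) + 1)) ρ =
      incBeta₀ (1 - ρ ^ 2) (2 * k - 2 + 1) ((m : ℤ) + 1) := by
  rw [betaFactor, Set.indicator_of_mem (by simp; omega), incBeta₀, neg_neg,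
    show 2 * k - 2 + 1 = 2 * k - 1 by omega]

/-! ### Fourier coefficients of a weight `2 - 2k` function on hyperbolic circles -/

/-- The function `f` on the unit disc with `F z = (z - ϱ̄) ^ (2k - 2) * f (X_ϱ z)`. -/
noncomputable def discFun (k : ℕ) (ϱ : ℍ) (F : ℍ → ℂ) (w : ℂ) : ℂ :=
  ((1 - w) / (2 * Complex.I * ϱ.im)) ^ (2 * k - 2) * (F ∘ ofComplex) (discPoint ϱ w)

/-- The integral over `0 ≤ θ ≤ 2π` of `w ^ (-n) * f w` with `w = exp (s + iθ)` and `f` as in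
`discFun`. -/
noncomputable def angularMean (k : ℕ) (ϱ : ℍ) (F : ℍ → ℂ) (n : ℤ) (s : ℝ) : ℂ :=
  ∫ θ in (0 : ℝ)..2 * Real.pi, Complex.exp (-(n * (s + θ * Complex.I))) *
    discFun k ϱ F (Complex.exp (s + θ * Complex.I))

/-- The conjugate of `2 y^{2-2k} ∂F/∂z̄`, as a function on `ℂ`, so that
`ξ_{2-2k} F` is `i` times it. -/
noncomputable def conjXi (k : ℕ) (F : ℍ → ℂ) (z : ℂ) : ℂ :=
  conj ((z.im : ℂ) ^ (2 * (1 - (k : ℤ))) * dbar (F ∘ ofComplex) z)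

/-- The function `conjXi` in the coordinate `ζ = log X_ϱ`, with the weight `2k` automorphy factor
and the differential `dz / dζ` included. -/
noncomputable def conjXiLog (k : ℕ) (ϱ : ℍ) (F : ℍ → ℂ) (ζ : ℂ) : ℂ :=
  2 * Complex.I * ϱ.im / (1 - Complex.exp ζ) ^ 2 * Complex.exp ζ *
    ((-2 * Complex.I * (1 - Complex.exp ζ)) ^ (2 * k - 2))⁻¹ *
      conjXi k F (discPoint ϱ (Complex.exp ζ))

/-- The integral over `0 ≤ θ ≤ 2π` of `w ^ n` times `conjXiLog`, with `w = exp (s + iθ)`. -/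
noncomputable def conjXiMean (k : ℕ) (ϱ : ℍ) (F : ℍ → ℂ) (n : ℤ) (s : ℝ) : ℂ :=
  ∫ θ in (0 : ℝ)..2 * Real.pi, Complex.exp (n * (s + θ * Complex.I)) *
    conjXiLog k ϱ F (s + θ * Complex.I)

lemma norm_exp_lt_one {ζ : ℂ} {L : ℝ} (hL : L ≤ 0) (h : ζ.re < L) : ‖Complex.exp ζ‖ < 1 := by
  rw [Complex.norm_exp, Real.exp_lt_one_iff]; linarith

lemma exp_add_two_pi_I (ζ : ℂ) : Complex.exp (ζ + 2 * Real.pi * Complex.I) = Complex.exp ζ :=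
  Complex.exp_periodic ζ

lemma exp_int_mul_add_two_pi_I (n : ℤ) (ζ : ℂ) :
    Complex.exp (n * (ζ + 2 * Real.pi * Complex.I)) = Complex.exp (n * ζ) := by
  rw [Complex.exp_int_mul, exp_add_two_pi_I, Complex.exp_int_mul]

lemma hasDerivAt_discPoint_exp (ϱ : ℍ) {ζ : ℂ} (h : ‖Complex.exp ζ‖ < 1) :
    HasDerivAt (fun ζ => discPoint ϱ (Complex.exp ζ))
      (2 * Complex.I * ϱ.im / (1 - Complex.exp ζ) ^ 2 * Complex.exp ζ) ζ :=
  (hasDerivAt_discPoint ϱ h).comp ζ (Complex.hasDerivAt_exp ζ)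

lemma dbar_exp_mul_discFun {k : ℕ} (hk : 1 ≤ k) (ϱ : ℍ) {F : ℍ → ℂ} (n : ℤ) {ζ : ℂ}
    (h : ‖Complex.exp ζ‖ < 1)
    (hF : DifferentiableAt ℝ (F ∘ ofComplex) (discPoint ϱ (Complex.exp ζ))) :
    dbar (fun ζ => Complex.exp (-(n * ζ)) * discFun k ϱ F (Complex.exp ζ)) ζ =
      ((1 - Real.exp ζ.re ^ 2) ^ (2 * k - 2) * Real.exp (-2 * n * ζ.re) : ℝ) *
        conj (Complex.exp (n * ζ) * conjXiLog k ϱ F ζ) := by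
  have hη : (ϱ.im : ℂ) ≠ 0 := by exact_mod_cast ϱ.im_pos.ne'
  have h1w := one_sub_ne_zero_of_norm_lt h
  have hA : HasDerivAt (fun ζ => Complex.exp (-(n * ζ)) *
      ((1 - Complex.exp ζ) / (2 * Complex.I * ϱ.im)) ^ (2 * k - 2)) _ ζ :=
    DifferentiableAt.hasDerivAt (by fun_prop)
  have key := dbar_mul_comp hA (hasDerivAt_discPoint_exp ϱ h) hF
  simp only [discFun, ← mul_assoc]
  rw [key, conjXiLog, conjXi]
  set w := Complex.exp ζ with hw
  set g := dbar (F ∘ ofComplex) (discPoint ϱ w)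
  set P := 2 * Complex.I * ϱ.im / (1 - w) ^ 2 * w
  have hy : (discPoint ϱ w).im ≠ 0 := (discPoint_im_pos ϱ h).ne'
  have hz : ((discPoint ϱ w).im : ℂ) ^ (2 * (1 - (k : ℤ))) =
      (((discPoint ϱ w).im : ℂ) ^ (2 * k - 2))⁻¹ := by
    rw [← zpow_natCast, ← zpow_neg]; congr 1; push_cast [show 2 ≤ 2 * k by omega]; ring
  have hexp : Complex.exp (-(n * ζ)) =
      (Real.exp (-2 * n * ζ.re) : ℂ) * conj (Complex.exp (n * ζ)) := by
    rw [← Complex.exp_conj, Complex.ofReal_exp, ← Complex.exp_add]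
    congr 1
    have := Complex.re_add_im ζ
    apply Complex.ext <;> simp
    ring
  have hc1 : 1 - conj w ≠ 0 := by
    have := (map_ne_zero (starRingEnd ℂ)).2 h1w
    simpa using this
  -- the base of the identity between the `(2k - 2)`-th powers: the formula for `Im` in the disc
  have hbase : (1 - w) / (2 * Complex.I * ϱ.im) =
      ((1 - Real.exp ζ.re ^ 2 : ℝ) : ℂ) * (2 * Complex.I * (1 - conj w))⁻¹ *
        ((discPoint ϱ w).im : ℂ)⁻¹ := by
    rw [discPoint_im, ← Complex.norm_exp ζ, ← hw]
    have e : ((‖1 - w‖ ^ 2 : ℝ) : ℂ) = (1 - w) * (1 - conj w) := by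
      rw [← Complex.normSq_eq_norm_sq, ← Complex.mul_conj]; simp
    have h3 : ((1 - ‖w‖ ^ 2 : ℝ) : ℂ) ≠ 0 := by
      have : 1 - ‖w‖ ^ 2 ≠ 0 := by nlinarith [norm_nonneg w]
      exact_mod_cast this
    rw [Complex.ofReal_div, Complex.ofReal_mul, e]
    field_simp
  have hconj : conj (((-2 * Complex.I * (1 - w)) ^ (2 * k - 2))⁻¹) =
      ((2 * Complex.I * (1 - conj w))⁻¹) ^ (2 * k - 2) := by
    rw [inv_pow, map_inv₀, map_pow]
    simp [map_ofNat (starRingEnd ℂ) 2]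
  clear_value P
  rw [map_mul, map_mul, map_mul, hconj, Complex.conj_conj, hz, hexp, hbase, mul_pow, mul_pow,
    inv_pow (_ : ℂ) (2 * k - 2), inv_pow (_ : ℂ) (2 * k - 2)]
  push_cast
  ring

lemma contDiffAt_discFun_exp {k : ℕ} (ϱ : ℍ) {F : ℍ → ℂ} (n : ℤ) {ζ : ℂ}
    (h : ‖Complex.exp ζ‖ < 1)
    (hF : ContDiffAt ℝ 1 (F ∘ ofComplex) (discPoint ϱ (Complex.exp ζ))) :
    ContDiffAt ℝ 1 (fun ζ => Complex.exp (-(n * ζ)) * discFun k ϱ F (Complex.exp ζ)) ζ := by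
  have h1w := one_sub_ne_zero_of_norm_lt h
  have h2 : ContDiffAt ℝ 1 (fun ζ => discPoint ϱ (Complex.exp ζ)) ζ := by
    unfold discPoint
    simp only [div_eq_mul_inv]
    exact ContDiffAt.mul (by fun_prop) (ContDiffAt.inv (by fun_prop) h1w)
  have h3 := ContDiffAt.comp ζ (f := fun ζ => discPoint ϱ (Complex.exp ζ)) hF h2
  unfold discFun
  exact ContDiffAt.mul (by fun_prop) (ContDiffAt.mul (by fun_prop) h3)

/-- The radial derivative of the angular means of `F` in terms of those of `ξF`. -/
lemma hasDerivAt_angularMean {k : ℕ} (hk : 1 ≤ k) (ϱ : ℍ) {F : ℍ → ℂ} {L : ℝ} (hL : L ≤ 0)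
    (hF : ∀ ζ : ℂ, ζ.re < L → ContDiffAt ℝ 1 (F ∘ ofComplex) (discPoint ϱ (Complex.exp ζ)))
    (n : ℤ) {s : ℝ} (hs : s < L) :
    HasDerivAt (angularMean k ϱ F n)
      (((1 - Real.exp s ^ 2) ^ (2 * k - 2) * Real.exp (-2 * n * s) : ℝ) *
        conj (conjXiMean k ϱ F n s)) s := by
  have h := hasDerivAt_integral_vertical (L := L)
    (v := fun ζ => Complex.exp (-(n * ζ)) * discFun k ϱ F (Complex.exp ζ))
    (fun ζ hζ => (contDiffAt_discFun_exp ϱ n (norm_exp_lt_one hL hζ) (hF ζ hζ)).contDiffWithinAt)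
    (fun ζ => by
      rw [exp_add_two_pi_I, Complex.exp_neg, exp_int_mul_add_two_pi_I, ← Complex.exp_neg]) hs
  convert! h using 1
  rw [conjXiMean, ← intervalIntegral.intervalIntegral_conj, ← intervalIntegral.integral_const_mul]
  refine intervalIntegral.integral_congr fun θ _ => ?_
  have hre : ((s : ℂ) + θ * Complex.I).re = s := by simp
  have hlt : ((s : ℂ) + θ * Complex.I).re < L := by rwa [hre]
  rw [dbar_exp_mul_discFun hk ϱ n (norm_exp_lt_one hL hlt)
    ((hF _ hlt).differentiableAt one_ne_zero), hre]

/-- Where `ξF` is holomorphic, its Laurent coefficients do not depend on the circle. -/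
lemma conjXiMean_eq {k : ℕ} (ϱ : ℍ) {F : ℍ → ℂ} {L : ℝ} (hL : L ≤ 0)
    (hF : ∀ ζ : ℂ, ζ.re < L → DifferentiableAt ℂ (conjXi k F) (discPoint ϱ (Complex.exp ζ)))
    (n : ℤ) {s t : ℝ} (hs : s < L) (ht : t < L) :
    conjXiMean k ϱ F n s = conjXiMean k ϱ F n t := by
  have hopen : IsOpen {ζ : ℂ | ζ.re < L} := isOpen_lt Complex.continuous_re continuous_const
  have hdiff : ∀ ζ : ℂ, ζ.re < L →
      DifferentiableAt ℂ (fun ζ => Complex.exp (n * ζ) * conjXiLog k ϱ F ζ) ζ := fun ζ hζ => by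
    have hlt := norm_exp_lt_one hL hζ
    have h1w := one_sub_ne_zero_of_norm_lt hlt
    have h1 := DifferentiableAt.comp ζ (f := fun ζ => discPoint ϱ (Complex.exp ζ)) (hF ζ hζ)
      (hasDerivAt_discPoint_exp ϱ hlt).differentiableAt
    unfold conjXiLog
    refine DifferentiableAt.mul (by fun_prop) (DifferentiableAt.mul (DifferentiableAt.mul
      (DifferentiableAt.mul (DifferentiableAt.div (by fun_prop) (by fun_prop) (pow_ne_zero _ h1w))
        (by fun_prop)) (DifferentiableAt.inv (by fun_prop) (pow_ne_zero _ ?_))) h1)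
    simp [h1w]
  have hC : ContDiffOn ℝ 1 (fun ζ => Complex.exp (n * ζ) * conjXiLog k ϱ F ζ) {ζ | ζ.re < L} :=
    (DifferentiableOn.contDiffOn (fun ζ hζ => (hdiff ζ hζ).differentiableWithinAt)
      hopen).restrict_scalars ℝ
  have hder : ∀ s : ℝ, s < L → HasDerivAt (conjXiMean k ϱ F n) 0 s := fun s hs => by
    have h := hasDerivAt_integral_vertical hC
      (fun ζ => by rw [exp_int_mul_add_two_pi_I, conjXiLog, exp_add_two_pi_I, conjXiLog]) hs
    convert! h using 1
    rw [intervalIntegral.integral_congr (g := fun _ => 0) fun θ _ => ?_]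
    · simp
    · exact dbar_eq_zero_of_hasDerivAt (hdiff _ (by simpa using hs)).hasDerivAt
  exact isOpen_Iio.is_const_of_deriv_eq_zero (convex_Iio L).isPreconnected
    (fun s hs => (hder s hs).differentiableAt.differentiableWithinAt)
    (fun s hs => (hder s hs).deriv) hs ht

/-- If `ξF` is bounded near `ϱ`, its angular means against `w ^ n` with `n ≥ 0` tend to `0`. -/
lemma tendsto_conjXiMean {k : ℕ} (ϱ : ℍ) {F : ℍ → ℂ} {n : ℤ} (hn : 0 ≤ n) {L B : ℝ}
    (hB : ∀ ζ : ℂ, ζ.re < L → ‖conjXi k F (discPoint ϱ (Complex.exp ζ))‖ ≤ B) :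
    Filter.Tendsto (conjXiMean k ϱ F n) Filter.atBot (𝓝 0) := by
  set C : ℝ := 2 * ϱ.im / (1 / 2) ^ 2 * ((2 * (1 / 2)) ^ (2 * k - 2))⁻¹ * B
  have hb : ∀ s : ℝ, s < L → Real.exp s ≤ 1 / 2 → ‖conjXiMean k ϱ F n s‖ ≤
      C * (2 * Real.pi) * Real.exp s := fun s hs hs2 => by
    have hs0 : s ≤ 0 := by
      have : Real.exp s ≤ 1 := by linarith
      rwa [Real.exp_le_one_iff] at this
    refine (intervalIntegral.norm_integral_le_of_norm_le_const (C := C * Real.exp s)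
      fun θ _ => ?_).trans (le_of_eq ?_)
    · set ζ : ℂ := s + θ * Complex.I with hζ
      have hre : ζ.re = s := by simp [hζ]
      have hnw : ‖Complex.exp ζ‖ = Real.exp s := by rw [Complex.norm_exp, hre]
      have h1 : 1 / 2 ≤ ‖1 - Complex.exp ζ‖ := by
        have := norm_sub_norm_le (1 : ℂ) (Complex.exp ζ)
        rw [hnw, norm_one] at this
        linarith
      have h2 : ‖Complex.exp (n * ζ)‖ ≤ 1 := by
        rw [Complex.norm_exp, Real.exp_le_one_iff]
        have : ((n : ℂ) * ζ).re = n * s := by simp [hre]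
        rw [this]
        exact mul_nonpos_of_nonneg_of_nonpos (by exact_mod_cast hn) hs0
      have hBζ := hB ζ (by rwa [hre])
      have hη := ϱ.im_pos
      have e : ‖conjXiLog k ϱ F ζ‖ = 2 * ϱ.im / ‖1 - Complex.exp ζ‖ ^ 2 * Real.exp s *
          ((2 * ‖1 - Complex.exp ζ‖) ^ (2 * k - 2))⁻¹ *
            ‖conjXi k F (discPoint ϱ (Complex.exp ζ))‖ := by
        rw [conjXiLog]
        simp [hnw, abs_of_pos hη]
      rw [norm_mul, e]
      calc _ ≤ 1 * (2 * ϱ.im / (1 / 2) ^ 2 * Real.exp s *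
            ((2 * (1 / 2)) ^ (2 * k - 2))⁻¹ * B) := by gcongr
        _ = _ := by ring
    · rw [sub_zero, abs_of_pos Real.two_pi_pos]; ring
  refine squeeze_zero_norm' (a := fun s => C * (2 * Real.pi) * Real.exp s) ?_ ?_
  · have h1 : ∀ᶠ s in Filter.atBot, Real.exp s ≤ 1 / 2 :=
      (Real.tendsto_exp_atBot.eventually (Iio_mem_nhds (by norm_num : (0 : ℝ) < 1 / 2))).mono
        fun s hs => le_of_lt hs
    filter_upwards [Filter.Iio_mem_atBot L, h1] with s hs hs2 using hb s hs hs2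
  · simpa using Real.tendsto_exp_atBot.const_mul (C * (2 * Real.pi))

/-! ### The elliptic expansion as a single series over `ℤ` -/

lemma indicator_merTerm (ϱ : ℍ) (n₀ : ℕ) (cp : ℤ → ℂ) (z : ℍ) :
    {n : ℤ | -(n₀ : ℤ) ≤ n}.indicator (merTerm ϱ cp z) =
      fun n => {n : ℤ | -(n₀ : ℤ) ≤ n}.indicator cp n * X ϱ z ^ n := by
  ext n
  by_cases h : n ∈ {n : ℤ | -(n₀ : ℤ) ≤ n} <;> simp [h, merTerm]

lemma indicator_betaTerm_add (k n₀ : ℕ) (ϱ : ℍ) (cm : ℤ → ℂ) (z : ℍ) :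
    (fun n => (Set.Icc 0 (nK k n₀)).indicator (betaTerm k ϱ cm z) n +
      {n : ℤ | n ≤ (n₀ : ℤ) ∧ n ∉ Set.Icc 0 (nK k n₀)}.indicator (beta₀Term k ϱ cm z) n) =
      fun n => {n : ℤ | n ≤ (n₀ : ℤ)}.indicator cm n * betaFactor k n₀ n (r ϱ z) * X ϱ z ^ n := by
  ext n
  have hle : nK k n₀ ≤ n₀ := min_le_right _ _
  by_cases h : n ∈ Set.Icc 0 (nK k n₀)
  · have h1 : n ≤ (n₀ : ℤ) := h.2.trans hle
    rw [Set.indicator_of_mem h, Set.indicator_of_notMem (fun h' => h'.2 h),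
      Set.indicator_of_mem (show n ∈ {n : ℤ | n ≤ (n₀ : ℤ)} from h1), betaFactor,
      Set.indicator_of_notMem (not_not_intro h), betaTerm]
    simp
  · rw [Set.indicator_of_notMem h, zero_add, betaFactor,
      Set.indicator_of_mem (show n ∈ (Set.Icc 0 (nK k n₀))ᶜ from h)]
    by_cases h1 : n ≤ (n₀ : ℤ)
    · rw [Set.indicator_of_mem (show n ∈ {n : ℤ | n ≤ (n₀ : ℤ)} from h1),
        Set.indicator_of_mem (show n ∈ {n : ℤ | n ≤ (n₀ : ℤ) ∧ n ∉ Set.Icc 0 (nK k n₀)} from ⟨h1, h⟩),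
        beta₀Term, incBeta₀]
    · rw [Set.indicator_of_notMem (fun h' => h1 h'.1),
        Set.indicator_of_notMem (show n ∉ {n : ℤ | n ≤ (n₀ : ℤ)} from h1)]
      simp

lemma summable_and_eq_tsum_indicator {S T : Set ℤ} {I : Finset ℤ} (f g h : ℤ → ℂ) (c x : ℂ) :
    (Summable (fun n : S => f n) ∧ Summable (fun n : T => h n) ∧
      x = c * ((∑' n : S, f n) + ∑ n ∈ I, g n + ∑' n : T, h n)) ↔
    (Summable (S.indicator f) ∧
      Summable (fun n => (I : Set ℤ).indicator g n + T.indicator h n) ∧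
      x = c * ∑' n, (S.indicator f n + ((I : Set ℤ).indicator g n + T.indicator h n))) := by
  have hfin : HasSum ((I : Set ℤ).indicator g) (∑ n ∈ I, g n) := by
    have := hasSum_sum_of_ne_finset_zero (L := SummationFilter.unconditional ℤ) (s := I)
      (f := (I : Set ℤ).indicator g) fun n hn => Set.indicator_of_notMem (by simpa using hn) _
    rwa [Finset.sum_congr rfl fun n hn => Set.indicator_of_mem (by simpa using hn) _] at this
  have e2 : Summable (T.indicator h) ↔
      Summable (fun n => (I : Set ℤ).indicator g n + T.indicator h n) :=
    ⟨fun h => hfin.summable.add h, fun h => by simpa using h.sub hfin.summable⟩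
  have e1 : Summable (fun n : S => f n) ↔ Summable (S.indicator f) :=
    summable_subtype_iff_indicator
  have e3 : Summable (fun n : T => h n) ↔ Summable (T.indicator h) :=
    summable_subtype_iff_indicator
  rw [tsum_subtype, tsum_subtype, ← e2, e1, e3]
  refine and_congr_right fun h1 => and_congr_right fun h2 => ?_
  rw [h1.tsum_add (hfin.summable.add h2), hfin.summable.tsum_add h2, hfin.tsum_eq, add_assoc]

/-- The three sums of the elliptic expansion merged into one series over `ℤ`, with `c⁺` and `c⁻`
extended by `0` outside their ranges. -/
lemma hasEllipticExpansion_iff {k n₀ : ℕ} {ϱ : ℍ} {R : ℝ} {F : ℍ → ℂ} {cp cm : ℤ → ℂ} :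
    HasEllipticExpansion k ϱ n₀ R F cp cm ↔ ∀ z : ℍ, z ≠ ϱ → r ϱ z < R →
      Summable (fun n => {n : ℤ | -(n₀ : ℤ) ≤ n}.indicator cp n * X ϱ z ^ n) ∧
      Summable (fun n => {n : ℤ | n ≤ (n₀ : ℤ)}.indicator cm n * betaFactor k n₀ n (r ϱ z) *
        X ϱ z ^ n) ∧
      F z = ((z : ℂ) - conj (ϱ : ℂ)) ^ (2 * k - 2) *
        ∑' n, ({n : ℤ | -(n₀ : ℤ) ≤ n}.indicator cp n +
          {n : ℤ | n ≤ (n₀ : ℤ)}.indicator cm n * betaFactor k n₀ n (r ϱ z)) * X ϱ z ^ n := by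
  refine forall_congr' fun z => forall_congr' fun _ => forall_congr' fun _ => ?_
  have key := summable_and_eq_tsum_indicator (S := {n : ℤ | -(n₀ : ℤ) ≤ n})
    (T := {n : ℤ | n ≤ (n₀ : ℤ) ∧ n ∉ Set.Icc 0 (nK k n₀)}) (I := Finset.Icc 0 (nK k n₀))
    (merTerm ϱ cp z) (betaTerm k ϱ cm z) (beta₀Term k ϱ cm z)
    (((z : ℂ) - conj (ϱ : ℂ)) ^ (2 * k - 2)) (F z)
  refine key.trans ?_
  have e : (fun n => ({n : ℤ | -(n₀ : ℤ) ≤ n}.indicator cp n +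
      {n : ℤ | n ≤ (n₀ : ℤ)}.indicator cm n * betaFactor k n₀ n (r ϱ z)) * X ϱ z ^ n) =
      fun n => {n : ℤ | -(n₀ : ℤ) ≤ n}.indicator cp n * X ϱ z ^ n +
        {n : ℤ | n ≤ (n₀ : ℤ)}.indicator cm n * betaFactor k n₀ n (r ϱ z) * X ϱ z ^ n :=
    funext fun n => add_mul _ _ _
  rw [e, Finset.coe_Icc, indicator_betaTerm_add, indicator_merTerm]
  simp only [congrFun (indicator_betaTerm_add k n₀ ϱ cm z)]

lemma eq_mul_discFun (k : ℕ) (ϱ : ℍ) (F : ℍ → ℂ) (z : ℍ) :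
    F z = ((z : ℂ) - conj (ϱ : ℂ)) ^ (2 * k - 2) * discFun k ϱ F (X ϱ z) := by
  have h := coe_sub_conj_coe_ne_zero ϱ z
  have h1 := discPoint_sub_conj ϱ (r_lt_one ϱ z)
  have h2 : (ϱ.im : ℂ) ≠ 0 := by exact_mod_cast ϱ.im_pos.ne'
  have h3 := one_sub_ne_zero_of_norm_lt (r_lt_one ϱ z)
  rw [discPoint_X] at h1
  rw [discFun, discPoint_X, h1, ← mul_assoc, ← mul_pow, Function.comp_apply, ofComplex_apply]
  rw [show 2 * Complex.I * (ϱ.im : ℂ) / (1 - X ϱ z) * ((1 - X ϱ z) / (2 * Complex.I * ϱ.im)) = 1 by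
    field_simp, one_pow, one_mul]

/-! ### Existence of the elliptic expansion -/

/-- Each angular mean of a harmonic function is a combination of the two radial solutions. -/
lemma exists_angularMean_eq {k : ℕ} (hk : 1 ≤ k) (ϱ : ℍ) {F : ℍ → ℂ} (n₀ : ℕ) {L : ℝ} (hL : L ≤ 0)
    (hF : ∀ ζ : ℂ, ζ.re < L →
      ContDiffAt ℝ 2 (F ∘ ofComplex) (discPoint ϱ (Complex.exp ζ)) ∧
      laplace (1 - (k : ℤ)) F (ofComplex (discPoint ϱ (Complex.exp ζ))) = 0) :
    ∃ p q : ℤ → ℂ, ∀ (n : ℤ) (s : ℝ), s < L → angularMean k ϱ F n s =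
      2 * Real.pi * (p n + q n * betaFactor k n₀ n (Real.exp s)) := by
  have hpi : (Real.pi : ℂ) ≠ 0 := by exact_mod_cast Real.pi_ne_zero
  have hhol : ∀ ζ : ℂ, ζ.re < L →
      DifferentiableAt ℂ (conjXi k F) (discPoint ϱ (Complex.exp ζ)) := fun ζ hζ => by
    have him := discPoint_im_pos ϱ (norm_exp_lt_one hL hζ)
    have h := hF ζ hζ
    have e : ((ofComplex (discPoint ϱ (Complex.exp ζ)) : ℍ) : ℂ) =
        discPoint ϱ (Complex.exp ζ) := by rw [ofComplex_apply_of_im_pos him]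
    have := differentiableAt_conj_zpow_mul_dbar (by rw [e]; exact h.1) h.2
    rwa [e] at this
  set D : ℤ → ℂ := fun n => conj (conjXiMean k ϱ F n (L - 1))
  have hlt : L - 1 < L := by linarith
  refine ⟨fun n => (angularMean k ϱ F n (L - 1) +
    D n / 2 * betaFactor k n₀ n (Real.exp (L - 1))) / (2 * Real.pi),
    fun n => -D n / (4 * Real.pi), fun n s hs => ?_⟩
  have hder : ∀ s : ℝ, s < L → HasDerivAt (fun s => angularMean k ϱ F n s +
      D n / 2 * betaFactor k n₀ n (Real.exp s)) 0 s := fun s hs => by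
    have h1 := hasDerivAt_angularMean hk ϱ hL
      (fun ζ hζ => (hF ζ hζ).1.of_le (by norm_num)) n hs
    have h2 := ((hasDerivAt_betaFactor_exp (k := k) n₀ n (s := s)).ofReal_comp).const_mul (D n / 2)
    convert! h1.add h2 using 1
    rw [conjXiMean_eq ϱ hL hhol n hs hlt]
    simp only [D]
    push_cast
    ring
  have := isOpen_Iio.is_const_of_deriv_eq_zero (convex_Iio L).isPreconnected
    (fun s hs => (hder s hs).differentiableAt.differentiableWithinAt)
    (fun s hs => (hder s hs).deriv) hs hlt
  simp only at this ⊢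
  rw [← this]
  field_simp
  ring

lemma norm_angularMean_le {k : ℕ} {ϱ : ℍ} {F : ℍ → ℂ} (n : ℤ) {s M : ℝ}
    (hM : ∀ θ : ℝ, ‖discFun k ϱ F (Complex.exp (s + θ * Complex.I))‖ ≤ M) :
    ‖angularMean k ϱ F n s‖ ≤ 2 * Real.pi * (M * Real.exp (-n * s)) := by
  refine (intervalIntegral.norm_integral_le_of_norm_le_const (C := M * Real.exp (-n * s))
    fun θ _ => ?_).trans (le_of_eq ?_)
  · rw [norm_mul, mul_comm, Complex.norm_exp]
    have : (-((n : ℂ) * (s + θ * Complex.I))).re = -n * s := by simp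
    rw [this]
    exact mul_le_mul_of_nonneg_right (hM θ) (Real.exp_pos _).le
  · rw [sub_zero, abs_of_pos Real.two_pi_pos]; ring

/-- Cauchy's estimate for the Fourier coefficients on a circle. -/
lemma norm_coeff_le {k : ℕ} {ϱ : ℍ} {F : ℍ → ℂ} {n : ℤ} {s M : ℝ} {a : ℂ}
    (ha : angularMean k ϱ F n s = 2 * Real.pi * a)
    (hM : ∀ θ : ℝ, ‖discFun k ϱ F (Complex.exp (s + θ * Complex.I))‖ ≤ M) :
    ‖a‖ ≤ M * Real.exp (-n * s) := by
  have h := norm_angularMean_le n hM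
  rw [ha, norm_mul] at h
  have : ‖(2 * Real.pi : ℂ)‖ = 2 * Real.pi := by
    simp [abs_of_pos Real.pi_pos]
  rw [this] at h
  exact le_of_mul_le_mul_left h Real.two_pi_pos

/-- A punctured neighbourhood of `ϱ` contains a punctured hyperbolic disc. -/
lemma exists_forall_discPoint_exp {ϱ : ℍ} {p : ℍ → Prop} (hp : ∀ᶠ z in 𝓝[≠] ϱ, p z) :
    ∃ s₀ ≤ 0, ∀ ζ : ℂ, ζ.re < s₀ → p (ofComplex (discPoint ϱ (Complex.exp ζ))) := by
  have hlt : ∀ᶠ w : ℂ in 𝓝[≠] 0, ‖w‖ < 1 :=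
    nhdsWithin_le_nhds (by
      filter_upwards [Metric.ball_mem_nhds (0 : ℂ) one_pos] with w hw using by simpa using hw)
  have h0 : discPoint ϱ 0 = ϱ := by simp [discPoint]
  have htend : Filter.Tendsto (fun w => ofComplex (discPoint ϱ w)) (𝓝[≠] 0) (𝓝[≠] ϱ) := by
    refine tendsto_nhdsWithin_iff.2 ⟨?_, ?_⟩
    · have h1 : ContinuousAt (fun w => ofComplex (discPoint ϱ w)) 0 := by
        refine ContinuousAt.comp (g := ofComplex) ?_
          (hasDerivAt_discPoint ϱ (by simp)).continuousAt
        rw [h0]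
        exact (contMDiffAt_ofComplex (n := 0) ϱ.im_pos).continuousAt
      have h2 := h1.tendsto
      rw [h0, ofComplex_apply] at h2
      exact h2.mono_left nhdsWithin_le_nhds
    · filter_upwards [hlt, self_mem_nhdsWithin] with w hw hw0 h
      have := X_ofComplex_discPoint ϱ hw
      rw [X_eq_zero_iff.2 h] at this
      exact hw0 this.symm
  have hev := htend.eventually hp
  rw [eventually_nhdsWithin_iff, Metric.eventually_nhds_iff] at hev
  obtain ⟨ε, hε, hev⟩ := hev
  refine ⟨min (Real.log ε) 0, min_le_right _ _, fun ζ hζ => ?_⟩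
  refine hev (y := Complex.exp ζ) ?_ (Complex.exp_ne_zero ζ)
  rw [dist_zero_right, Complex.norm_exp, ← Real.exp_log hε]
  exact Real.exp_lt_exp.2 (hζ.trans_le (min_le_left _ _))

lemma exists_norm_discFun_exp_le (k : ℕ) (ϱ : ℍ) {F : ℍ → ℂ} {n₀ : ℕ} {B : ℝ}
    (hB : ∀ᶠ z : ℍ in 𝓝[≠] ϱ, ‖((r ϱ z ^ n₀ : ℝ) : ℂ) * F z‖ ≤ B) :
    ∃ C s₀ : ℝ, ∀ ζ : ℂ, ζ.re < s₀ →
      ‖discFun k ϱ F (Complex.exp ζ)‖ ≤ C * Real.exp (-n₀ * ζ.re) := by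
  obtain ⟨s₀, hs₀, hB⟩ := exists_forall_discPoint_exp hB
  refine ⟨(1 / ϱ.im) ^ (2 * k - 2) * B, s₀, fun ζ hζ => ?_⟩
  have hn : ‖Complex.exp ζ‖ = Real.exp ζ.re := Complex.norm_exp ζ
  have h1 := hB ζ hζ
  have h2 := norm_exp_lt_one hs₀ hζ
  rw [r, X_ofComplex_discPoint ϱ h2, norm_mul, Complex.norm_real, hn, Real.norm_eq_abs,
    abs_of_pos (pow_pos (Real.exp_pos _) _)] at h1
  have hη := ϱ.im_pos
  rw [discFun, norm_mul, norm_pow, norm_div, Function.comp_apply]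
  have h3 : ‖2 * Complex.I * (ϱ.im : ℂ)‖ = 2 * ϱ.im := by simp [abs_of_pos hη]
  have h4 : ‖1 - Complex.exp ζ‖ ≤ 2 := by
    refine (norm_sub_le _ _).trans ?_
    rw [norm_one]; linarith
  have h5 : ‖F (ofComplex (discPoint ϱ (Complex.exp ζ)))‖ ≤ B * Real.exp (-n₀ * ζ.re) := by
    rw [neg_mul, Real.exp_neg, Real.exp_nat_mul, ← div_eq_mul_inv,
      le_div_iff₀ (pow_pos (Real.exp_pos _) _), mul_comm]
    exact h1
  rw [h3, mul_assoc]
  refine mul_le_mul (pow_le_pow_left₀ (by positivity) ?_ _) h5 (norm_nonneg _) (by positivity)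
  rw [div_le_div_iff₀ (by positivity) hη]
  nlinarith

lemma tendsto_mul_exp_atBot (C : ℝ) {a : ℝ} (ha : 0 < a) :
    Filter.Tendsto (fun s => C * Real.exp (a * s)) Filter.atBot (𝓝 0) := by
  simpa using (Real.tendsto_exp_atBot.comp
    (Filter.tendsto_id.const_mul_atBot ha)).const_mul C

/-- The growth bound of order `n₀` excludes the non-meromorphic solution for `n > n₀`. -/
lemma coeff_minus_eq_zero {k n₀ : ℕ} {n : ℤ} (hn : (n₀ : ℤ) < n) {p q : ℂ} {C s₀ : ℝ}
    (h : ∀ s : ℝ, s < s₀ → ‖p + q * betaFactor k n₀ n (Real.exp s)‖ ≤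
      C * Real.exp ((-n₀ - n : ℝ) * s)) : q = 0 := by
  obtain ⟨m, rfl⟩ : ∃ m : ℕ, n = m := ⟨n.toNat, by omega⟩
  set K := (Set.Icc 0 (nK k n₀))ᶜ.indicator (fun n => betaConst (2 * k - 1) (-n)) (m : ℤ) with hK
  set c : ℝ := (1 / 2) ^ (2 * k - 1 - 1) * (2 ^ (m + 1))⁻¹ with hc
  have hc0 : 0 < c := by positivity
  have hm : (n₀ : ℝ) < m := by exact_mod_cast hn
  have hm0 : (0 : ℝ) < m := lt_of_le_of_lt (Nat.cast_nonneg _) hm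
  have hbound : ∀ᶠ s in Filter.atBot, ‖q‖ * c ≤
      ‖q * K - p‖ * Real.exp ((2 * m : ℝ) * s) + C * Real.exp ((m - n₀ : ℝ) * s) := by
    have h1 : ∀ᶠ s in Filter.atBot, Real.exp s < 1 / 2 :=
      Real.tendsto_exp_atBot.eventually (Iio_mem_nhds (by norm_num))
    filter_upwards [Filter.Iio_mem_atBot s₀, h1] with s hs hs1
    have hs2 := h s hs
    have hpos := Real.exp_pos s
    have hb := le_incBeta_one_sub (2 * k - 1) m (x := Real.exp s ^ 2) (by positivity)
      (by nlinarith)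
    rw [betaFactor, ← hK] at hs2
    set I := incBeta (1 - Real.exp s ^ 2) (2 * k - 1) (-m)
    have e1 : Real.exp ((2 * m : ℝ) * s) = (Real.exp s ^ 2) ^ m := by
      rw [← pow_mul, ← Real.exp_nat_mul]; push_cast; rfl
    have e2 : Real.exp ((-n₀ - (m : ℤ) : ℝ) * s) * Real.exp ((2 * m : ℝ) * s) =
        Real.exp ((m - n₀ : ℝ) * s) := by
      rw [← Real.exp_add]; congr 1; push_cast; ring
    have hE := Real.exp_pos ((2 * m : ℝ) * s)
    have h3 : c ≤ I * Real.exp ((2 * m : ℝ) * s) := by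
      rw [← hc, mul_inv_le_iff₀ (by positivity)] at hb
      rwa [e1]
    have h4 : ‖q‖ * I ≤ ‖q * K - p‖ + C * Real.exp ((-n₀ - (m : ℤ) : ℝ) * s) := by
      have e3 : q * (I : ℂ) = (q * K - p) + (p + q * ((I - K : ℝ) : ℂ)) := by push_cast; ring
      calc ‖q‖ * I ≤ ‖q‖ * ‖(I : ℂ)‖ := by
            gcongr; rw [Complex.norm_real]; exact le_abs_self I
        _ = ‖(q * K - p) + (p + q * ((I - K : ℝ) : ℂ))‖ := by rw [← norm_mul, e3]
        _ ≤ _ := (norm_add_le _ _).trans (by gcongr)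
    calc ‖q‖ * c ≤ ‖q‖ * (I * Real.exp ((2 * m : ℝ) * s)) := by gcongr
      _ = ‖q‖ * I * Real.exp ((2 * m : ℝ) * s) := by ring
      _ ≤ (‖q * K - p‖ + C * Real.exp ((-n₀ - (m : ℤ) : ℝ) * s)) *
          Real.exp ((2 * m : ℝ) * s) := by gcongr
      _ = _ := by rw [add_mul, mul_assoc C, e2]
  have hlim := (tendsto_mul_exp_atBot ‖q * K - p‖ (by linarith : (0 : ℝ) < 2 * m)).add
    (tendsto_mul_exp_atBot C (sub_pos.2 hm))
  have := ge_of_tendsto hlim hbound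
  have h5 : ‖q‖ ≤ 0 := by nlinarith [norm_nonneg q]
  exact norm_le_zero_iff.1 h5

/-- The growth bound of order `n₀` excludes the meromorphic solution for `n < -n₀`. -/
lemma coeff_plus_eq_zero {k n₀ : ℕ} (hk : 1 ≤ k) {n : ℤ} (hn : n < -(n₀ : ℤ)) {p q : ℂ} {C s₀ : ℝ}
    (h : ∀ s : ℝ, s < s₀ → ‖p + q * betaFactor k n₀ n (Real.exp s)‖ ≤
      C * Real.exp ((-n₀ - n : ℝ) * s)) : p = 0 := by
  have hn' : (n : ℝ) < -n₀ := by exact_mod_cast hn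
  obtain ⟨m, rfl⟩ : ∃ m : ℕ, n = -((m : ℤ) + 1) := ⟨(-n - 1).toNat, by omega⟩
  have hbound : ∀ᶠ s in Filter.atBot, ‖p‖ ≤
      C * Real.exp ((-n₀ - (-((m : ℤ) + 1) : ℤ) : ℝ) * s) +
        (‖q‖ / (m + 1)) * Real.exp ((2 * (m + 1) : ℝ) * s) := by
    filter_upwards [Filter.Iio_mem_atBot s₀, Filter.Iio_mem_atBot 0] with s hs hs0
    have hs2 := h s hs
    have he1 : Real.exp s < 1 := Real.exp_lt_one_iff.2 hs0
    have hb := abs_incBeta₀_le (2 * k - 2) m (x := Real.exp s ^ 2) (by positivity)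
      (by nlinarith [Real.exp_pos s])
    rw [← betaFactor_of_neg hk n₀] at hb
    have e1 : Real.exp ((2 * (m + 1) : ℝ) * s) = (Real.exp s ^ 2) ^ (m + 1) := by
      rw [← pow_mul, ← Real.exp_nat_mul]; push_cast; rfl
    set b := betaFactor k n₀ (-((m : ℤ) + 1)) (Real.exp s)
    calc ‖p‖ = ‖(p + q * b) - q * b‖ := by rw [add_sub_cancel_right]
      _ ≤ _ := (norm_sub_le _ _).trans (add_le_add hs2 ?_)
    rw [norm_mul, Complex.norm_real, Real.norm_eq_abs, e1, div_mul_eq_mul_div, mul_div_assoc]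
    gcongr
  have hlim := (tendsto_mul_exp_atBot C (show
      (0 : ℝ) < -n₀ - (-((m : ℤ) + 1) : ℤ) by linarith)).add
    (tendsto_mul_exp_atBot (‖q‖ / (m + 1)) (show (0 : ℝ) < 2 * (m + 1) by positivity))
  have := ge_of_tendsto hlim hbound
  simpa using this

lemma summable_int_of_eventually_nat {f : ℤ → ℂ} {N : ℕ} {C a : ℝ} (ha : 0 < a)
    (h1 : ∀ n : ℕ, N < n → ‖f n‖ ≤ C * Real.exp (-a * n)) (h2 : ∀ n : ℤ, n < -N → f n = 0) :
    Summable f := by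
  refine Summable.of_nat_of_neg ?_ ?_
  · have hg : Summable fun n : ℕ => C * Real.exp (-a * n) := by
      have := (summable_geometric_of_lt_one (Real.exp_pos (-a)).le
        (Real.exp_lt_one_iff.2 (neg_lt_zero.2 ha))).mul_left C
      refine this.congr fun n => ?_
      rw [← Real.exp_nat_mul, mul_comm (-a)]
    refine hg.of_norm_bounded_eventually_nat ?_
    filter_upwards [Filter.eventually_gt_atTop N] with n hn using h1 n hn
  · refine summable_of_ne_finset_zero (s := Finset.range (N + 1)) fun n hn => h2 _ ?_
    simp only [Finset.mem_range, not_lt] at hn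
    omega

lemma exp_add_mul_I_zpow (s θ : ℝ) (n : ℤ) : Complex.exp (s + θ * Complex.I) ^ n =
    Real.exp (n * s) * Complex.exp (n * θ * Complex.I) := by
  rw [← Complex.exp_int_mul, Complex.ofReal_exp, ← Complex.exp_add]
  congr 1
  push_cast
  ring

lemma periodic_discFun_exp (k : ℕ) (ϱ : ℍ) (F : ℍ → ℂ) (s : ℝ) : Function.Periodic
    (fun θ : ℝ => discFun k ϱ F (Complex.exp (s + θ * Complex.I))) (2 * Real.pi) := fun θ => by
  simp only
  rw [show (s : ℂ) + ((θ + 2 * Real.pi : ℝ) : ℂ) * Complex.I =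
    (s + θ * Complex.I) + 2 * Real.pi * Complex.I by push_cast; ring, exp_add_two_pi_I]

lemma exists_norm_discFun_le {k : ℕ} {ϱ : ℍ} {F : ℍ → ℂ} {s : ℝ}
    (hc : Continuous fun θ : ℝ => discFun k ϱ F (Complex.exp (s + θ * Complex.I))) :
    ∃ M : ℝ, ∀ θ : ℝ, ‖discFun k ϱ F (Complex.exp (s + θ * Complex.I))‖ ≤ M := by
  obtain ⟨M, hM⟩ := ((periodic_discFun_exp k ϱ F s).isBounded_of_continuous
    Real.two_pi_pos.ne' hc).exists_norm_le
  exact ⟨M, fun θ => hM _ ⟨θ, rfl⟩⟩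

/-- Absolute convergence on the circle `r_ϱ = exp s` by comparison with the circle `r_ϱ = exp t`:
for `n > n₀` the coefficient `p n` alone makes up the angular mean of index `n`. -/
lemma summable_plus {k n₀ : ℕ} {ϱ : ℍ} {F : ℍ → ℂ} {p q : ℤ → ℂ} {s t M : ℝ} (hst : s < t)
    (hpq : ∀ n : ℤ, angularMean k ϱ F n t =
      2 * Real.pi * (p n + q n * betaFactor k n₀ n (Real.exp t)))
    (hM : ∀ θ : ℝ, ‖discFun k ϱ F (Complex.exp (t + θ * Complex.I))‖ ≤ M)
    (hp : ∀ n : ℤ, n < -(n₀ : ℤ) → p n = 0) (hq : ∀ n : ℤ, (n₀ : ℤ) < n → q n = 0) :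
    Summable fun n : ℤ => p n * Real.exp (n * s) := by
  refine summable_int_of_eventually_nat (N := n₀) (C := M) (sub_pos.2 hst) (fun n hn => ?_)
    fun n hn => by rw [hp n hn, zero_mul]
  have h := norm_coeff_le (hpq n) hM
  rw [hq n (by exact_mod_cast hn), zero_mul, add_zero] at h
  rw [norm_mul, Complex.norm_real, Real.norm_eq_abs, abs_of_pos (Real.exp_pos _)]
  refine (mul_le_mul_of_nonneg_right h (Real.exp_pos _).le).trans (le_of_eq ?_)
  rw [mul_assoc, ← Real.exp_add]
  congr 2
  push_cast
  ring

/-- Absolute convergence on the circle `r_ϱ = exp s` by comparison with the circle `r_ϱ = exp t`: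
for `n < -n₀` the angular mean of index `n` is `q n` times a radial factor of exact order
`exp (-2ns) / |n|`. -/
lemma summable_minus {k n₀ : ℕ} (hk : 1 ≤ k) {ϱ : ℍ} {F : ℍ → ℂ} {p q : ℤ → ℂ} {s t M : ℝ}
    (hst : s < t) (ht : t < 0)
    (hpq : ∀ n : ℤ, angularMean k ϱ F n t =
      2 * Real.pi * (p n + q n * betaFactor k n₀ n (Real.exp t)))
    (hM : ∀ θ : ℝ, ‖discFun k ϱ F (Complex.exp (t + θ * Complex.I))‖ ≤ M)
    (hp : ∀ n : ℤ, n < -(n₀ : ℤ) → p n = 0) (hq : ∀ n : ℤ, (n₀ : ℤ) < n → q n = 0) :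
    Summable fun n : ℤ => q n * betaFactor k n₀ n (Real.exp s) * Real.exp (n * s) := by
  have ht1 : Real.exp t < 1 := Real.exp_lt_one_iff.2 ht
  have hs1 : Real.exp s < 1 := Real.exp_lt_one_iff.2 (hst.trans ht)
  have ht0 := Real.exp_pos t
  have hs0 := Real.exp_pos s
  set δ : ℝ := (1 - Real.exp t ^ 2) ^ (2 * k - 2) with hδ
  have hδ0 : 0 < δ := pow_pos (by nlinarith) _
  have hneg : Summable fun n : ℤ =>
      q (-n) * betaFactor k n₀ (-n) (Real.exp s) * Real.exp ((-n : ℤ) * s) := by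
    refine summable_int_of_eventually_nat (N := n₀) (C := M / δ) (sub_pos.2 hst)
      (fun n hn => ?_) fun n hn => by rw [hq (-n) (by omega), zero_mul, zero_mul]
    obtain ⟨m, rfl⟩ : ∃ m : ℕ, n = m + 1 := ⟨n - 1, by omega⟩
    have h := norm_coeff_le (hpq (-((m : ℤ) + 1))) hM
    have hle := abs_incBeta₀_le (2 * k - 2) m (x := Real.exp s ^ 2) (by positivity) (by nlinarith)
    have hge := le_abs_incBeta₀ (2 * k - 2) m (x := Real.exp t ^ 2) (by positivity) (by nlinarith)
    rw [← betaFactor_of_neg hk n₀] at hle hge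
    rw [hp _ (by omega), zero_add, norm_mul, Complex.norm_real, Real.norm_eq_abs] at h
    rw [Nat.cast_add_one, norm_mul, norm_mul, Complex.norm_real, Complex.norm_real,
      Real.norm_eq_abs, Real.norm_eq_abs, abs_of_pos (Real.exp_pos _)]
    set bs := |betaFactor k n₀ (-((m : ℤ) + 1)) (Real.exp s)|
    set bt := |betaFactor k n₀ (-((m : ℤ) + 1)) (Real.exp t)|
    set Q := ‖q (-((m : ℤ) + 1))‖
    have hQ : 0 ≤ Q := norm_nonneg _
    have e : ∀ x : ℝ, (Real.exp x ^ 2) ^ (m + 1) = Real.exp (2 * (m + 1) * x) := fun x => by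
      rw [← pow_mul, ← Real.exp_nat_mul]; push_cast; rfl
    rw [e] at hle hge
    have hm : (0 : ℝ) < m + 1 := by positivity
    have h6 : Q * (Real.exp (2 * (m + 1) * t) / (m + 1)) ≤
        M / δ * Real.exp (((m : ℝ) + 1) * t) := by
      rw [div_mul_eq_mul_div, le_div_iff₀ hδ0]
      calc _ = Q * (δ * (Real.exp (2 * (m + 1) * t) / (m + 1))) := by ring
        _ ≤ Q * bt := by gcongr
        _ ≤ _ := h
        _ = _ := by congr 2; push_cast; ring
    calc Q * bs * Real.exp ((-((m : ℤ) + 1) : ℤ) * s)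
        ≤ Q * (Real.exp (2 * (m + 1) * s) / (m + 1)) *
          Real.exp ((-((m : ℤ) + 1) : ℤ) * s) := by gcongr
      _ = Q * (Real.exp (2 * (m + 1) * t) / (m + 1)) *
          Real.exp ((m + 1 : ℝ) * s - 2 * (m + 1) * t) := by
        have e2 : Real.exp (2 * (m + 1) * s) * Real.exp ((-((m : ℤ) + 1) : ℤ) * s) =
            Real.exp (2 * (m + 1) * t) * Real.exp ((m + 1 : ℝ) * s - 2 * (m + 1) * t) := by
          rw [← Real.exp_add, ← Real.exp_add]
          congr 1
          push_cast
          ring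
        linear_combination Q / (m + 1) * e2
      _ ≤ M / δ * Real.exp (((m : ℝ) + 1) * t) * Real.exp ((m + 1 : ℝ) * s - 2 * (m + 1) * t) := by
        gcongr
      _ = _ := by
        rw [mul_assoc, ← Real.exp_add]
        congr 2
        push_cast
        ring
  have := (Equiv.neg ℤ).summable_iff.2 hneg
  refine this.congr fun n => ?_
  simp

theorem exists_hasEllipticExpansion {k : ℕ} (hk : 1 ≤ k) (ϱ : ℍ) (F : ℍ → ℂ) (n₀ : ℕ) (R : ℝ)
    (hR : 0 < R)
    (hF : ∀ z : ℍ, z ≠ ϱ → r ϱ z < R →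
      ContDiffAt ℝ 2 (F ∘ ofComplex) (z : ℂ) ∧ laplace (1 - (k : ℤ)) F z = 0)
    (hB : ∃ B : ℝ, ∀ᶠ z : ℍ in 𝓝[≠] ϱ, ‖((r ϱ z ^ n₀ : ℝ) : ℂ) * F z‖ ≤ B) :
    ∃ cp cm : ℤ → ℂ, HasEllipticExpansion k ϱ n₀ R F cp cm := by
  obtain ⟨B, hB⟩ := hB
  set L := Real.log (min R 1) with hLdef
  have hmin : 0 < min R 1 := lt_min hR one_pos
  have hL : L ≤ 0 := Real.log_nonpos hmin.le (min_le_right _ _)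
  have hFL : ∀ ζ : ℂ, ζ.re < L →
      ContDiffAt ℝ 2 (F ∘ ofComplex) (discPoint ϱ (Complex.exp ζ)) ∧
      laplace (1 - (k : ℤ)) F (ofComplex (discPoint ϱ (Complex.exp ζ))) = 0 := fun ζ hζ => by
    have hlt := norm_exp_lt_one hL hζ
    have hX := X_ofComplex_discPoint ϱ hlt
    have h := hF (ofComplex (discPoint ϱ (Complex.exp ζ)))
      (fun h => Complex.exp_ne_zero ζ (by rw [← hX, X_eq_zero_iff.2 h])) (by
        rw [r, hX, Complex.norm_exp]
        exact ((Real.lt_log_iff_exp_lt hmin).1 hζ).trans_le (min_le_left _ _))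
    have e : ((ofComplex (discPoint ϱ (Complex.exp ζ)) : ℍ) : ℂ) =
        discPoint ϱ (Complex.exp ζ) := by
      rw [ofComplex_apply_of_im_pos (discPoint_im_pos ϱ hlt)]
    rwa [e] at h
  obtain ⟨p, q, hpq⟩ := exists_angularMean_eq hk ϱ n₀ hL hFL
  obtain ⟨C, s₀, hC⟩ := exists_norm_discFun_exp_le k ϱ hB
  have hgrowth : ∀ (n : ℤ) (s : ℝ), s < min L s₀ →
      ‖p n + q n * betaFactor k n₀ n (Real.exp s)‖ ≤ C * Real.exp ((-n₀ - n : ℝ) * s) :=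
    fun n s hs => by
      have hs' := lt_min_iff.1 hs
      refine (norm_coeff_le (hpq n s hs'.1)
        (fun θ => by simpa using hC (s + θ * Complex.I) (by simpa using hs'.2))).trans
          (le_of_eq ?_)
      rw [mul_assoc, ← Real.exp_add]
      congr 2
      ring
  have hp : ∀ n : ℤ, n < -(n₀ : ℤ) → p n = 0 := fun n hn => coeff_plus_eq_zero hk hn (hgrowth n)
  have hq : ∀ n : ℤ, (n₀ : ℤ) < n → q n = 0 := fun n hn => coeff_minus_eq_zero hn (hgrowth n)
  have hcont : ∀ s : ℝ, s < L →
      Continuous fun θ : ℝ => discFun k ϱ F (Complex.exp (s + θ * Complex.I)) := fun s hs => by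
    have h : ContinuousOn (fun ζ => discFun k ϱ F (Complex.exp ζ)) {ζ | ζ.re < L} := fun ζ hζ => by
      have := contDiffAt_discFun_exp (k := k) ϱ 0 (norm_exp_lt_one hL hζ)
        ((hFL ζ hζ).1.of_le (by norm_num))
      simpa using this.continuousAt.continuousWithinAt
    exact h.comp_continuous (by fun_prop) fun θ => by simpa using hs
  have hindp : {n : ℤ | -(n₀ : ℤ) ≤ n}.indicator p = p :=
    Set.indicator_eq_self.2 fun n hn => not_lt.1 fun h => hn (hp n h)
  have hindq : {n : ℤ | n ≤ (n₀ : ℤ)}.indicator q = q :=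
    Set.indicator_eq_self.2 fun n hn => not_lt.1 fun h => hn (hq n h)
  refine ⟨p, q, hasEllipticExpansion_iff.2 fun z hz hzR => ?_⟩
  rw [hindp, hindq]
  have hX0 : X ϱ z ≠ 0 := fun h => hz (X_eq_zero_iff.1 h)
  have hr0 : 0 < r ϱ z := norm_pos_iff.2 hX0
  set s := Real.log (r ϱ z) with hs
  set θ := (X ϱ z).arg
  have hes : Real.exp s = r ϱ z := Real.exp_log hr0
  have hXexp : X ϱ z = Complex.exp (s + θ * Complex.I) := by
    rw [Complex.exp_add, ← Complex.ofReal_exp, hes, r, Complex.norm_mul_exp_arg_mul_I]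
  have hsL : s < L := Real.log_lt_log hr0 (lt_min hzR (r_lt_one ϱ z))
  obtain ⟨t, hst, htL⟩ := exists_between hsL
  obtain ⟨M, hM⟩ := exists_norm_discFun_le (hcont t htL)
  have hsp := summable_plus hst (fun n => hpq n t htL) hM hp hq
  have hsm := summable_minus hk hst (htL.trans_le hL) (fun n => hpq n t htL) hM hp hq
  have hnorm : ∀ n : ℤ, ‖X ϱ z ^ n‖ = ‖(Real.exp (n * s) : ℂ)‖ := fun n => by
    rw [hXexp, exp_add_mul_I_zpow, norm_mul, show (n : ℂ) * θ * Complex.I = ((n * θ : ℝ) : ℂ) * Complex.I by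
      push_cast; ring, Complex.norm_exp_ofReal_mul_I, mul_one]
  refine ⟨?_, ?_, ?_⟩
  · refine hsp.norm.of_norm_bounded fun n => le_of_eq ?_
    rw [norm_mul, norm_mul, hnorm]
  · refine hsm.norm.of_norm_bounded fun n => le_of_eq ?_
    rw [norm_mul, norm_mul (_ * _), hnorm, hes]
  · rw [eq_mul_discFun k ϱ F z]
    congr 1
    set A : ℤ → ℂ := fun n => (p n + q n * betaFactor k n₀ n (r ϱ z)) * Real.exp (n * s)
    have hA : Summable A := (hsp.add hsm).congr fun n => by simp only [A, hes]; ring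
    have hsum := hasSum_fourier_of_summable (A := A) (hcont s hsL)
      (periodic_discFun_exp k ϱ F s) (fun n => by
        have h := hpq n s hsL
        rw [hes] at h
        simp only [A]
        rw [← mul_assoc, ← h, angularMean, ← intervalIntegral.integral_mul_const]
        refine intervalIntegral.integral_congr fun θ _ => ?_
        rw [mul_right_comm (Complex.exp (-(n * (s + θ * Complex.I)))), Complex.ofReal_exp,
          ← Complex.exp_add, mul_comm]
        congr 2
        push_cast
        ring) hA θ
    rw [← hXexp] at hsum
    rw [← hsum.tsum_eq]
    refine tsum_congr fun n => ?_
    rw [hXexp, exp_add_mul_I_zpow]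
    simp only [A]
    ring

/-! ### The stabilizer of a point in the modular group -/

/-- The automorphy factor `cz + d` of an element of `SL₂(ℤ)`. -/
noncomputable def autFactor (M : SL(2, ℤ)) (z : ℂ) : ℂ := (M 1 0 : ℂ) * z + M 1 1

lemma autFactor_ne_zero (M : SL(2, ℤ)) (z : ℍ) : autFactor M z ≠ 0 := by
  have := denom_ne_zero (M : GL (Fin 2) ℝ) z
  rwa [ModularGroup.denom_apply] at this

lemma det_eq_one (M : SL(2, ℤ)) : M 0 0 * M 1 1 - M 0 1 * M 1 0 = 1 := by
  rw [← Matrix.det_fin_two]; exact M.2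

lemma det_eq_one' (M : SL(2, ℤ)) : (M 0 0 : ℂ) * M 1 1 - M 0 1 * M 1 0 = 1 := by
  exact_mod_cast det_eq_one M

lemma coe_smul_eq (M : SL(2, ℤ)) (z : ℍ) :
    ((M • z : ℍ) : ℂ) = ((M 0 0 : ℂ) * z + M 0 1) / autFactor M z := by
  rw [coe_specialLinearGroup_apply]
  simp [autFactor]

lemma num_eq_of_smul_eq {M : SL(2, ℤ)} {ϱ : ℍ} (h : M • ϱ = ϱ) :
    (M 0 0 : ℂ) * ϱ + M 0 1 = ϱ * autFactor M ϱ := by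
  have := coe_smul_eq M ϱ
  rw [h, eq_div_iff (autFactor_ne_zero M ϱ)] at this
  exact this.symm

lemma conj_autFactor (M : SL(2, ℤ)) (z : ℂ) : conj (autFactor M z) = autFactor M (conj z) := by
  simp [autFactor]

lemma autFactor_mul_conj {M : SL(2, ℤ)} {ϱ : ℍ} (h : M • ϱ = ϱ) :
    autFactor M ϱ * conj (autFactor M ϱ) = 1 := by
  have h1 := num_eq_of_smul_eq h
  have h2 := congrArg conj h1
  simp only [map_add, map_mul, map_intCast, conj_autFactor] at h2
  have h0 := coe_sub_conj_ne_zero ϱ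
  rw [conj_autFactor]
  refine mul_left_cancel₀ h0 ?_
  have hdet := det_eq_one' M
  unfold autFactor at *
  linear_combination -(((M 1 0 : ℂ) * conj (ϱ : ℂ) + M 1 1)) * h1 +
    ((M 1 0 : ℂ) * ϱ + M 1 1) * h2 + ((ϱ : ℂ) - conj (ϱ : ℂ)) * hdet

/-- In the disc coordinate, an element of the stabilizer of `ϱ` acts as a rotation. -/
lemma X_smul {M : SL(2, ℤ)} {ϱ : ℍ} (h : M • ϱ = ϱ) (z : ℍ) :
    X ϱ (M • z) = conj (autFactor M ϱ) ^ 2 * X ϱ z ∧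
    ((M • z : ℍ) : ℂ) - conj (ϱ : ℂ) =
      (z - conj (ϱ : ℂ)) / (autFactor M z * conj (autFactor M ϱ)) := by
  have h1 := num_eq_of_smul_eq h
  have h2 := congrArg conj h1
  simp only [map_add, map_mul, map_intCast, conj_autFactor] at h2
  have hdet := det_eq_one' M
  have hm := autFactor_mul_conj h
  have hz := autFactor_ne_zero M z
  have hϱ := autFactor_ne_zero M ϱ
  have hϱ' : conj (autFactor M ϱ) ≠ 0 := (map_ne_zero _).2 hϱ
  have e1 : ((M • z : ℍ) : ℂ) - conj (ϱ : ℂ) =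
      (z - conj (ϱ : ℂ)) / (autFactor M z * conj (autFactor M ϱ)) := by
    rw [coe_smul_eq, conj_autFactor, sub_eq_iff_eq_add, div_eq_iff hz, add_mul, div_mul_eq_mul_div,
      mul_comm (autFactor M z), mul_div_mul_right _ _ hz, ← sub_eq_iff_eq_add,
      eq_div_iff (by rwa [← conj_autFactor])]
    unfold autFactor at *
    linear_combination ((M 1 0 : ℂ) * z + M 1 1) * h2 + ((z : ℂ) - conj (ϱ : ℂ)) * hdet
  have e2 : ((M • z : ℍ) : ℂ) - ϱ = (z - ϱ) / (autFactor M z * autFactor M ϱ) := by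
    rw [coe_smul_eq, sub_eq_iff_eq_add, div_eq_iff hz, add_mul, div_mul_eq_mul_div,
      mul_comm (autFactor M z), mul_div_mul_right _ _ hz, ← sub_eq_iff_eq_add, eq_div_iff hϱ]
    unfold autFactor at *
    linear_combination ((M 1 0 : ℂ) * z + M 1 1) * h1 + ((z : ℂ) - ϱ) * hdet
  refine ⟨?_, e1⟩
  have h0 := coe_sub_conj_coe_ne_zero ϱ z
  rw [X, e1, e2, X]
  field_simp
  linear_combination (ϱ - z : ℂ) * hm

/-- The character `M ↦ (cϱ + d)²` of the stabilizer of `ϱ`. -/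
noncomputable def stabilizerCharacter (ϱ : ℍ) : MulAction.stabilizer SL(2, ℤ) ϱ →* ℂˣ :=
  ((MonoidHom.toHomUnits
    { toFun := fun M => autFactor (M : SL(2, ℤ)) ϱ
      map_one' := by simp [autFactor]
      map_mul' := fun M N => by
        have h := num_eq_of_smul_eq (MulAction.mem_stabilizer_iff.1 N.2)
        have e0 : ((M : SL(2, ℤ)) * (N : SL(2, ℤ))) 1 0 = (M : SL(2, ℤ)) 1 0 * (N : SL(2, ℤ)) 0 0 +
          (M : SL(2, ℤ)) 1 1 * (N : SL(2, ℤ)) 1 0 := by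
            simp [Matrix.mul_apply, Fin.sum_univ_two]
        have e1 : ((M : SL(2, ℤ)) * (N : SL(2, ℤ))) 1 1 = (M : SL(2, ℤ)) 1 0 * (N : SL(2, ℤ)) 0 1 +
          (M : SL(2, ℤ)) 1 1 * (N : SL(2, ℤ)) 1 1 := by
            simp [Matrix.mul_apply, Fin.sum_univ_two]
        unfold autFactor at *
        rw [Subgroup.coe_mul, e0, e1]
        push_cast
        linear_combination ((M : SL(2, ℤ)) 1 0 : ℂ) * h } :
      MulAction.stabilizer SL(2, ℤ) ϱ →* ℂˣ)) ^ 2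

lemma coe_stabilizerCharacter (ϱ : ℍ) (M : MulAction.stabilizer SL(2, ℤ) ϱ) :
    (stabilizerCharacter ϱ M : ℂ) = autFactor (M : SL(2, ℤ)) ϱ ^ 2 := by
  simp [stabilizerCharacter]

lemma mem_center_iff_entries (M : SL(2, ℤ)) :
    M ∈ Subgroup.center SL(2, ℤ) ↔ M 0 1 = 0 ∧ M 1 0 = 0 ∧ M 0 0 = M 1 1 := by
  rw [Matrix.SpecialLinearGroup.mem_center_iff]
  constructor
  · rintro ⟨a, -, ha⟩
    rw [← ha, Matrix.scalar_apply]
    exact ⟨Matrix.diagonal_apply_ne _ zero_ne_one, Matrix.diagonal_apply_ne _ one_ne_zero, by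
      rw [Matrix.diagonal_apply_eq, Matrix.diagonal_apply_eq]⟩
  · rintro ⟨h1, h2, h3⟩
    have hd := det_eq_one M
    refine ⟨M 1 1, ?_, ?_⟩
    · rw [h1, h3] at hd
      simp only [Fintype.card_fin]
      linarith
    · rw [Matrix.scalar_apply]
      ext i j
      fin_cases i <;> fin_cases j <;> simp [h1, h2, h3]

lemma stabilizerCharacter_eq_one_iff (ϱ : ℍ) (M : MulAction.stabilizer SL(2, ℤ) ϱ) :
    stabilizerCharacter ϱ M = 1 ↔ (M : SL(2, ℤ)) ∈ Subgroup.center SL(2, ℤ) := by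
  obtain ⟨M, hM⟩ := M
  have hM' := num_eq_of_smul_eq (MulAction.mem_stabilizer_iff.1 hM)
  have hd := det_eq_one M
  have him : ϱ.im ≠ 0 := ϱ.im_pos.ne'
  rw [← Units.val_inj, coe_stabilizerCharacter, Units.val_one, mem_center_iff_entries]
  simp only
  constructor
  · intro h
    have hc : M 1 0 = 0 := by
      rcases sq_eq_one_iff.1 h with h | h <;>
      · have := congrArg Complex.im h
        simpa [autFactor, him] using this
    have hre := congrArg Complex.re hM'
    have him' := congrArg Complex.im hM'
    simp only [autFactor, hc] at hre him'
    have ha : M 0 0 = M 1 1 := by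
      have : (M 0 0 : ℝ) * ϱ.im = (M 1 1 : ℝ) * ϱ.im := by simpa [mul_comm] using him'
      exact_mod_cast mul_right_cancel₀ him this
    refine ⟨?_, hc, ha⟩
    rw [ha] at hre
    have : (M 0 1 : ℝ) = 0 := by simpa [mul_comm] using hre
    exact_mod_cast this
  · rintro ⟨hb, hc, ha⟩
    rw [hb, ha] at hd
    rw [autFactor, hc]
    have : (M 1 1 : ℂ) * M 1 1 = 1 := by exact_mod_cast (by linarith : M 1 1 * M 1 1 = 1)
    simpa [sq] using this

/-- If every value of the character `M ↦ (cϱ + d)²` is a `j`-th root of unity, then `ω_ϱ ∣ j`: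
for `j ≠ 0` the values form a finite cyclic group of order `ω_ϱ`. The finiteness of the stabilizer is
a consequence and need not be known beforehand. -/
lemma omega_dvd {ϱ : ℍ} {j : ℤ} (h : ∀ M : SL(2, ℤ), M • ϱ = ϱ → (autFactor M ϱ ^ 2) ^ j = 1) :
    (omega ϱ : ℤ) ∣ j := by
  rcases eq_or_ne j 0 with rfl | hj
  · exact dvd_zero _
  set S := MulAction.stabilizer SL(2, ℤ) ϱ
  set ψ : S →* SL(2, ℤ) ⧸ Subgroup.center SL(2, ℤ) :=
    (QuotientGroup.mk' (Subgroup.center SL(2, ℤ))).comp S.subtype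
  have hker : ψ.ker = (stabilizerCharacter ϱ).ker := by
    ext M
    rw [MonoidHom.mem_ker, MonoidHom.mem_ker, stabilizerCharacter_eq_one_iff]
    simp [ψ]
  have hω : omega ϱ = Nat.card (stabilizerCharacter ϱ).range := by
    have hr : S.map (QuotientGroup.mk' (Subgroup.center SL(2, ℤ))) = ψ.range := by
      rw [MonoidHom.range_comp, Subgroup.range_subtype]
    rw [omega, hr]
    exact Nat.card_congr (((QuotientGroup.quotientKerEquivRange ψ).symm.trans
      (QuotientGroup.quotientMulEquivOfEq hker)).trans
        (QuotientGroup.quotientKerEquivRange (stabilizerCharacter ϱ))).toEquiv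
  have hroot : ∀ g ∈ (stabilizerCharacter ϱ).range, g ^ j.natAbs = 1 := by
    rintro _ ⟨M, rfl⟩
    have h1 : (stabilizerCharacter ϱ M) ^ j = 1 := by
      rw [← Units.val_inj, Units.val_zpow_eq_zpow_val, coe_stabilizerCharacter]
      exact h M (MulAction.mem_stabilizer_iff.1 M.2)
    rcases Int.natAbs_eq j with e | e <;> rw [e] at h1
    · exact_mod_cast h1
    · simpa using h1
  have : NeZero j.natAbs := ⟨Int.natAbs_ne_zero.2 hj⟩
  have hle : (stabilizerCharacter ϱ).range ≤ rootsOfUnity j.natAbs ℂ := fun g hg =>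
    (mem_rootsOfUnity _ _).2 (hroot g hg)
  have hfin : Finite (stabilizerCharacter ϱ).range :=
    Finite.of_injective _ (Subgroup.inclusion_injective hle)
  rw [hω, ← IsCyclic.exponent_eq_card, ← Int.dvd_natAbs, Int.natCast_dvd_natCast,
    Monoid.exponent_dvd_iff_forall_pow_eq_one]
  intro g
  exact Subtype.ext (hroot g g.2)

/-! ### Vanishing of coefficients -/

lemma exists_X_eq_exp (ϱ : ℍ) {L : ℝ} (hL : L ≤ 0) {s : ℝ} (hs : s < L) (θ : ℝ) :
    ∃ z : ℍ, z ≠ ϱ ∧ r ϱ z = Real.exp s ∧ X ϱ z = Complex.exp (s + θ * Complex.I) := by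
  have hX := X_ofComplex_discPoint ϱ (norm_exp_lt_one hL
    (show ((s : ℂ) + θ * Complex.I).re < L by simpa using hs))
  refine ⟨_, fun h => ?_, ?_, hX⟩
  · exact Complex.exp_ne_zero _ (hX.symm.trans (X_eq_zero_iff.2 h))
  · rw [r, hX, Complex.norm_exp]; simp

/-- The elliptic expansion as a Fourier series on the circle `r_ϱ = exp s`. -/
lemma hasSum_of_hasEllipticExpansion {k n₀ : ℕ} {ϱ : ℍ} {R : ℝ} {F : ℍ → ℂ} {cp cm : ℤ → ℂ}
    (h : HasEllipticExpansion k ϱ n₀ R F cp cm) {z : ℍ} (hz : z ≠ ϱ) (hzR : r ϱ z < R) :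
    HasSum (fun n => ({n : ℤ | -(n₀ : ℤ) ≤ n}.indicator cp n +
      {n : ℤ | n ≤ (n₀ : ℤ)}.indicator cm n * betaFactor k n₀ n (r ϱ z)) * X ϱ z ^ n)
      (discFun k ϱ F (X ϱ z)) := by
  obtain ⟨h1, h2, h3⟩ := hasEllipticExpansion_iff.1 h z hz hzR
  have hs : Summable (fun n => ({n : ℤ | -(n₀ : ℤ) ≤ n}.indicator cp n +
      {n : ℤ | n ≤ (n₀ : ℤ)}.indicator cm n * betaFactor k n₀ n (r ϱ z)) * X ϱ z ^ n) :=
    (h1.add h2).congr fun n => by ring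
  rw [eq_mul_discFun k ϱ F z] at h3
  rw [mul_left_cancel₀ (pow_ne_zero _ (coe_sub_conj_coe_ne_zero ϱ z)) h3]
  exact hs.hasSum

/-- The two radial solutions are linearly independent. -/
lemma eq_zero_of_forall_betaFactor {k n₀ : ℕ} {n : ℤ} {p q : ℂ} {L : ℝ} (hL : L ≤ 0)
    (h : ∀ s : ℝ, s < L → p + q * betaFactor k n₀ n (Real.exp s) = 0) : p = 0 ∧ q = 0 := by
  have h1 := h (L - 1) (by linarith)
  have h2 := h (L - 2) (by linarith)
  have hne := betaFactor_ne (k := k) n₀ n (Real.exp_pos (L - 2))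
    (Real.exp_lt_exp.2 (by linarith : L - 2 < L - 1)) (Real.exp_lt_one_iff.2 (by linarith))
  have hq : q = 0 := by
    have h3 : q * ((betaFactor k n₀ n (Real.exp (L - 2)) : ℂ) -
        betaFactor k n₀ n (Real.exp (L - 1))) = 0 := by linear_combination h2 - h1
    refine (mul_eq_zero.1 h3).resolve_right (sub_ne_zero.2 ?_)
    exact_mod_cast hne
  exact ⟨by simpa [hq] using h1, hq⟩

lemma coeff_eq_zero_of_indicator {n₀ : ℕ} {n : ℤ} {cp cm : ℤ → ℂ}
    (h : {n : ℤ | -(n₀ : ℤ) ≤ n}.indicator cp n = 0 ∧ {n : ℤ | n ≤ (n₀ : ℤ)}.indicator cm n = 0) :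
    (-(n₀ : ℤ) ≤ n → cp n = 0) ∧ (n ≤ (n₀ : ℤ) → cm n = 0) :=
  ⟨fun hn => by simpa [hn] using h.1, fun hn => by simpa [hn] using h.2⟩

/-- Invariance under an element of the stabilizer of `ϱ`, in the disc coordinate. -/
lemma discFun_X_smul {k : ℕ} (hk : 1 ≤ k) {ϱ : ℍ} {F : ℍ → ℂ} {M : SL(2, ℤ)} (hM : M • ϱ = ϱ)
    (hF : F ∣[2 * (1 - (k : ℤ))] M = F) (z : ℍ) :
    discFun k ϱ F (X ϱ (M • z)) =
      conj (autFactor M ϱ) ^ (2 * k - 2) * discFun k ϱ F (X ϱ z) := by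
  have hJ := autFactor_ne_zero M z
  have hε : conj (autFactor M ϱ) ≠ 0 := (map_ne_zero _).2 (autFactor_ne_zero M ϱ)
  have h1 : F (M • z) * autFactor M z ^ (2 * k - 2) = F z := by
    have h := congrFun hF z
    rw [ModularForm.SL_slash_apply, ModularGroup.denom_apply] at h
    rwa [show -(2 * (1 - (k : ℤ))) = ((2 * k - 2 : ℕ) : ℤ) by omega, zpow_natCast] at h
  have h0 := coe_sub_conj_coe_ne_zero ϱ z
  rw [eq_mul_discFun k ϱ F z, eq_mul_discFun k ϱ F (M • z), (X_smul hM z).2, div_pow, mul_pow] at h1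
  have hJ' := pow_ne_zero (2 * k - 2) hJ
  have hε' := pow_ne_zero (2 * k - 2) hε
  have h0' := pow_ne_zero (2 * k - 2) h0
  field_simp at h1
  exact h1

/-- For `F` of weight `2 - 2k`, only exponents `n ≡ k - 1` modulo `ω_ϱ` occur. -/
theorem coeff_eq_zero_of_not_modEq {k : ℕ} (hk : 1 ≤ k) {ϱ : ℍ} {F : ℍ → ℂ}
    (hF : ∀ M : SL(2, ℤ), F ∣[2 * (1 - (k : ℤ))] M = F) {n₀ : ℕ} {R : ℝ} {cp cm : ℤ → ℂ}
    (hR : 0 < R) (h : HasEllipticExpansion k ϱ n₀ R F cp cm) {n : ℤ}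
    (hn : ¬ n ≡ (k : ℤ) - 1 [ZMOD (omega ϱ : ℤ)]) :
    (-(n₀ : ℤ) ≤ n → cp n = 0) ∧ (n ≤ (n₀ : ℤ) → cm n = 0) := by
  obtain ⟨M, hM, hne⟩ : ∃ M : SL(2, ℤ), M • ϱ = ϱ ∧
      (autFactor M ϱ ^ 2) ^ (n - ((k : ℤ) - 1)) ≠ 1 := by
    by_contra! hall
    exact hn ((Int.modEq_iff_dvd.2 (omega_dvd hall)).symm)
  refine coeff_eq_zero_of_indicator ?_
  set L := Real.log (min R 1)
  have hmin : 0 < min R 1 := lt_min hR one_pos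
  have hL : L ≤ 0 := Real.log_nonpos hmin.le (min_le_right _ _)
  refine eq_zero_of_forall_betaFactor (k := k) (n₀ := n₀) (n := n) hL fun s hs => ?_
  have hsR : Real.exp s < R := ((Real.lt_log_iff_exp_lt hmin).1 hs).trans_le (min_le_left _ _)
  set ε := conj (autFactor M ϱ) with hεdef
  have hε0 : ε ≠ 0 := (map_ne_zero _).2 (autFactor_ne_zero M ϱ)
  set b : ℤ → ℂ := fun n => {n : ℤ | -(n₀ : ℤ) ≤ n}.indicator cp n +
      {n : ℤ | n ≤ (n₀ : ℤ)}.indicator cm n * betaFactor k n₀ n (Real.exp s) with hb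
  have hzero : ∀ θ : ℝ, HasSum (fun n : ℤ => ((ε ^ 2) ^ n - ε ^ (2 * k - 2)) * b n *
      Real.exp (n * s) * Complex.exp (n * θ * Complex.I)) 0 := fun θ => by
    obtain ⟨z, hz, hr, hX⟩ := exists_X_eq_exp ϱ hL hs θ
    have hXM := (X_smul hM z).1
    have hnε : ‖ε‖ = 1 := by
      have := congrArg norm (autFactor_mul_conj hM)
      rw [norm_mul, ← hεdef, ← Complex.norm_conj (autFactor M ϱ), norm_one] at this
      nlinarith [norm_nonneg ε]
    have hrM : r ϱ (M • z) = Real.exp s := by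
      rw [r, hXM, norm_mul, norm_pow, hnε, one_pow, one_mul]; exact hr
    have hzM : M • z ≠ ϱ := fun h => hz (by
      rw [← hM] at h; exact smul_left_cancel M h)
    have h1 := hasSum_of_hasEllipticExpansion h hz (by rwa [hr])
    have h2 := hasSum_of_hasEllipticExpansion h hzM (by rwa [hrM])
    rw [discFun_X_smul hk hM (hF M), hXM, hrM] at h2
    rw [hr] at h1
    have h3 := h2.sub (h1.mul_left (ε ^ (2 * k - 2)))
    rw [sub_self] at h3
    refine h3.congr_fun fun n => ?_
    rw [mul_zpow, hX, exp_add_mul_I_zpow]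
    simp only [hb]
    ring
  have hsum : Summable fun n : ℤ => ((ε ^ 2) ^ n - ε ^ (2 * k - 2)) * b n * Real.exp (n * s) := by
    simpa using (hzero 0).summable
  have h4 := integral_mul_exp_of_hasSum hsum hzero n
  simp only [zero_mul, intervalIntegral.integral_zero] at h4
  have hpi : (2 * Real.pi : ℂ) ≠ 0 := by exact_mod_cast Real.two_pi_pos.ne'
  have hexp : (Real.exp (n * s) : ℂ) ≠ 0 := by exact_mod_cast (Real.exp_pos _).ne'
  have hfac : (ε ^ 2) ^ n - ε ^ (2 * k - 2) ≠ 0 := fun h5 => hne (by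
    have h6 : (ε ^ 2) ^ (n - ((k : ℤ) - 1)) = 1 := by
      rw [zpow_sub₀ (pow_ne_zero 2 hε0), sub_eq_zero.1 h5,
        show 2 * k - 2 = 2 * (k - 1) by omega, pow_mul, ← zpow_natCast (ε ^ 2),
        show (((k - 1 : ℕ)) : ℤ) = (k : ℤ) - 1 by omega]
      exact div_self (zpow_ne_zero _ (pow_ne_zero 2 hε0))
    have h7 := congrArg conj h6
    simpa [hεdef] using h7)
  have h8 := (mul_eq_zero.1 h4.symm).resolve_left hpi
  have h9 := (mul_eq_zero.1 h8).resolve_right hexp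
  exact (mul_eq_zero.1 h9).resolve_left hfac

/-- The angular means of a function with an elliptic expansion are its Fourier coefficients. -/
lemma angularMean_of_hasEllipticExpansion {k n₀ : ℕ} {ϱ : ℍ} {R : ℝ} {F : ℍ → ℂ} {cp cm : ℤ → ℂ}
    (h : HasEllipticExpansion k ϱ n₀ R F cp cm) {s : ℝ} (hs0 : s < 0) (hsR : Real.exp s < R)
    (n : ℤ) :
    angularMean k ϱ F n s = 2 * Real.pi * ({n : ℤ | -(n₀ : ℤ) ≤ n}.indicator cp n +
      {n : ℤ | n ≤ (n₀ : ℤ)}.indicator cm n * betaFactor k n₀ n (Real.exp s)) := by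
  set b : ℤ → ℂ := fun n => {n : ℤ | -(n₀ : ℤ) ≤ n}.indicator cp n +
      {n : ℤ | n ≤ (n₀ : ℤ)}.indicator cm n * betaFactor k n₀ n (Real.exp s) with hb
  have hsum : ∀ θ : ℝ, HasSum (fun n : ℤ => b n * Real.exp (n * s) *
      Complex.exp (n * θ * Complex.I)) (discFun k ϱ F (Complex.exp (s + θ * Complex.I))) :=
    fun θ => by
      obtain ⟨z, hz, hr, hX⟩ := exists_X_eq_exp ϱ le_rfl hs0 θ
      have h1 := hasSum_of_hasEllipticExpansion h hz (by rwa [hr])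
      rw [hX, hr] at h1
      refine h1.congr_fun fun n => ?_
      rw [exp_add_mul_I_zpow, mul_assoc]
  have hs : Summable fun n : ℤ => b n * Real.exp (n * s) := by simpa using (hsum 0).summable
  have h4 := integral_mul_exp_of_hasSum hs hsum n
  have hexp : (Real.exp (n * s) : ℂ) ≠ 0 := by exact_mod_cast (Real.exp_pos _).ne'
  refine mul_right_cancel₀ hexp ?_
  rw [mul_assoc, ← h4, angularMean, ← intervalIntegral.integral_mul_const]
  refine intervalIntegral.integral_congr fun θ _ => ?_
  rw [mul_right_comm (Complex.exp (-(n * (s + θ * Complex.I)))), Complex.ofReal_exp,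
    ← Complex.exp_add, mul_comm]
  congr 2
  push_cast
  ring

/-- A polar harmonic Maass form is real analytic in a punctured neighbourhood of every point. -/
lemma eventually_isRealAnalyticAt {κ : ℤ} {F : ℍ → ℂ} (hF : IsPolarHarmonicMaassForm κ F) (ϱ : ℍ) :
    ∀ᶠ z in 𝓝[≠] ϱ, IsRealAnalyticAt F z := by
  by_cases h : IsRealAnalyticAt F ϱ
  · refine nhdsWithin_le_nhds ?_
    exact (UpperHalfPlane.continuous_coe.tendsto ϱ).eventually h.eventually_analyticAt
  · have h1 := disjoint_nhdsWithin_of_mem_discrete hF.discrete h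
    obtain ⟨U, hU, hdisj⟩ := h1
    filter_upwards [hU] with z hz
    by_contra hz'
    exact Set.disjoint_left.1 hdisj hz hz'

/-- If `ξF` is a cusp form, in particular bounded near `ϱ`, no non-meromorphic terms with `n ≥ 0`
occur. -/
theorem coeff_minus_eq_zero_of_cusp {k : ℕ} (hk : 1 ≤ k) {ϱ : ℍ} {F : ℍ → ℂ}
    (hF : IsPolarHarmonicMaassFormCusp (1 - (k : ℤ)) F) {n₀ : ℕ} {R : ℝ} {cp cm : ℤ → ℂ}
    (hR : 0 < R) (h : HasEllipticExpansion k ϱ n₀ R F cp cm) {n : ℤ} (hn : 0 ≤ n)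
    (hn₀ : n ≤ (n₀ : ℤ)) : cm n = 0 := by
  obtain ⟨hF, g, hg⟩ := hF
  have hgc : ContinuousAt g ϱ := (CuspFormClass.holo g).continuous.continuousAt
  have hgb : ∀ᶠ z in 𝓝[≠] ϱ, ‖g z‖ < ‖g ϱ‖ + 1 :=
    nhdsWithin_le_nhds (hgc.norm.eventually (Iio_mem_nhds (lt_add_one _)))
  obtain ⟨s₀, hs₀, hP⟩ :=
    exists_forall_discPoint_exp ((eventually_isRealAnalyticAt hF ϱ).and hgb)
  set L := min s₀ (Real.log R)
  have hL : L ≤ 0 := (min_le_left _ _).trans hs₀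
  have hcoe : ∀ ζ : ℂ, ζ.re < s₀ → ((ofComplex (discPoint ϱ (Complex.exp ζ)) : ℍ) : ℂ) =
      discPoint ϱ (Complex.exp ζ) := fun ζ hζ => by
    rw [ofComplex_apply_of_im_pos (discPoint_im_pos ϱ (norm_exp_lt_one hs₀ hζ))]
  have hC : ∀ ζ : ℂ, ζ.re < s₀ →
      ContDiffAt ℝ 1 (F ∘ ofComplex) (discPoint ϱ (Complex.exp ζ)) := fun ζ hζ => by
    have h1 := (hP ζ hζ).1
    rw [IsRealAnalyticAt, hcoe ζ hζ] at h1
    exact h1.contDiffAt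
  have hB : ∀ ζ : ℂ, ζ.re < s₀ →
      ‖conjXi k F (discPoint ϱ (Complex.exp ζ))‖ ≤ ‖g ϱ‖ + 1 := fun ζ hζ => by
    have h1 := hg _ (hP ζ hζ).1
    have h2 := (hP ζ hζ).2.le
    rw [← h1, xi, ← coe_im, hcoe ζ hζ] at h2
    refine le_trans (le_of_eq ?_) h2
    rw [conjXi, Complex.norm_conj, dbar, map_div₀]
    simp only [norm_mul, norm_div, Complex.norm_conj]
    simp
    ring
  have hlim := tendsto_conjXiMean (k := k) ϱ hn hB
  set Q := {n : ℤ | n ≤ (n₀ : ℤ)}.indicator cm n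
  have hconst : ∀ᶠ s in Filter.atBot, conjXiMean k ϱ F n s = conj (-4 * Real.pi * Q) := by
    filter_upwards [Filter.Iio_mem_atBot L] with s hs
    have hs1 : s < s₀ := hs.trans_le (min_le_left _ _)
    have h1 := hasDerivAt_angularMean hk ϱ hs₀ hC n hs1
    have h2 := (((((hasDerivAt_betaFactor_exp (k := k) n₀ n (s := s)).ofReal_comp).const_mul
      Q).const_add ({n : ℤ | -(n₀ : ℤ) ≤ n}.indicator cp n)).const_mul
        (2 * Real.pi : ℂ)).congr_of_eventuallyEq (f₁ := angularMean k ϱ F n) (by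
      filter_upwards [Iio_mem_nhds hs] with t ht
      have ht1 : t < L := ht
      exact angularMean_of_hasEllipticExpansion h (ht1.trans_le hL)
        ((Real.lt_log_iff_exp_lt hR).1 (ht1.trans_le (min_le_right _ _))) n)
    have h4 := h1.unique h2
    set E : ℝ := (1 - Real.exp s ^ 2) ^ (2 * k - 2) * Real.exp (-2 * n * s) with hE
    have hE0 : (E : ℂ) ≠ 0 := by
      have h5 : Real.exp s < 1 := Real.exp_lt_one_iff.2 (lt_of_lt_of_le hs hL)
      have h6 : 0 < 1 - Real.exp s ^ 2 := by nlinarith [Real.exp_pos s]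
      have : 0 < E := by positivity
      exact_mod_cast this.ne'
    have h7 : conj (conjXiMean k ϱ F n s) = -4 * Real.pi * Q := by
      refine mul_left_cancel₀ hE0 (h4.trans ?_)
      rw [show -2 * (1 - Real.exp s ^ 2) ^ (2 * k - 2) * Real.exp (-2 * n * s) = -2 * E by
        rw [hE]; ring]
      push_cast
      ring
    rw [← h7, Complex.conj_conj]
  have h8 := tendsto_nhds_unique (hlim.congr' hconst) tendsto_const_nhds
  have h9 : Q = 0 := by simpa using h8.symm
  simpa [Q, hn₀] using h9

theorem proposition2p2 (k : ℕ) (hk : 1 ≤ k) (ϱ : ℍ) :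
    -- existence of the elliptic expansion
    (∀ (F : ℍ → ℂ) (n₀ : ℕ) (R : ℝ), 0 < R →
      (∀ z : ℍ, z ≠ ϱ → PolarMaass.r ϱ z < R →
        ContDiffAt ℝ 2 (F ∘ ofComplex) (z : ℂ) ∧ PolarMaass.laplace (1 - (k : ℤ)) F z = 0) →
      (∃ B : ℝ, ∀ᶠ z : ℍ in 𝓝[≠] ϱ, ‖((PolarMaass.r ϱ z ^ n₀ : ℝ) : ℂ) * F z‖ ≤ B) →
      ∃ cp cm : ℤ → ℂ, PolarMaass.HasEllipticExpansion k ϱ n₀ R F cp cm) ∧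
    -- polar harmonic Maass forms: only `n ≡ k - 1 (mod ω_ϱ)` occur
    (∀ F : ℍ → ℂ, PolarMaass.IsPolarHarmonicMaassForm (1 - (k : ℤ)) F →
      ∀ (n₀ : ℕ) (R : ℝ) (cp cm : ℤ → ℂ), 0 < R →
        PolarMaass.HasEllipticExpansion k ϱ n₀ R F cp cm →
        (∀ n : ℤ, -(n₀ : ℤ) ≤ n → ¬ n ≡ (k : ℤ) - 1 [ZMOD (PolarMaass.omega ϱ : ℤ)] → cp n = 0) ∧
        (∀ n : ℤ, n ≤ (n₀ : ℤ) → ¬ n ≡ (k : ℤ) - 1 [ZMOD (PolarMaass.omega ϱ : ℤ)] → cm n = 0)) ∧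
    -- forms mapping to cusp forms: no non-meromorphic terms with `n ≥ 0`
    (∀ F : ℍ → ℂ, PolarMaass.IsPolarHarmonicMaassFormCusp (1 - (k : ℤ)) F →
      ∀ (n₀ : ℕ) (R : ℝ) (cp cm : ℤ → ℂ), 0 < R →
        PolarMaass.HasEllipticExpansion k ϱ n₀ R F cp cm →
        ∀ n : ℤ, 0 ≤ n → n ≤ (n₀ : ℤ) → cm n = 0) := by
  refine ⟨fun F n₀ R hR hF hB => exists_hasEllipticExpansion hk ϱ F n₀ R hR hF hB,
    fun F hF n₀ R cp cm hR h => ⟨fun n hn hmod => ?_, fun n hn hmod => ?_⟩,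
    fun F hF n₀ R cp cm hR h n hn hn₀ => coeff_minus_eq_zero_of_cusp hk hF hR h hn hn₀⟩
  · exact (coeff_eq_zero_of_not_modEq hk hF.slash hR h hmod).1 hn
  · exact (coeff_eq_zero_of_not_modEq hk hF.slash hR h hmod).2 hn
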